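/- Let $\operatorname{Pic}=\mathbb Z\mathcal H_x\oplus\mathbb Z\mathcal H_y\oplus\bigoplus_{i=1}^8\mathbb Z\mathcal E_i$ be the Picard lattice of $\mathbb P^1\times\mathbb P^1$ blown up at eight points, with $\mathcal H_x\bullet\mathcal H_y=1$, $\mathcal E_i\bullet\mathcal E_j=-\delta_{ij}$ and all other products of these basis elements equal to $0$. Put $\delta=2\mathcal H_x+2\mathcal H_y-\sum_i\mathcal E_i$, and let $w_a(D)=D+(a\bullet D)a$ for $a\in\operatorname{Pic}$ with $a\bullet a=-2$. Let $W(E_8^{(1)})$ be the group of automorphisms of $\operatorname{Pic}$ generated by the reflections in $\alpha_0=\mathcal E_1-\mathcal E_2$, $\alpha_1=\mathcal H_x-\mathcal H_y$, $\alpha_2=\mathcal H_y-\mathcal E_1-\mathcal E_2$, $\alpha_j=\mathcal E_{j-1}-\mathcal E_j$ $(3\le j\le 8)$. Let $\mathbb T=\mathbb C/(\mathbb Z+\mathbb Z\tau)$ with $\operatorname{Im}\tau>0$. A choice of parameters $h_x,h_y,e_1,\dots,e_8\in\mathbb T$ defines a homomorphism $\iota^*:\operatorname{Pic}\to\mathbb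 T$ by $\mathcal H_x\mapsto h_x$, $\mathcal H_y\mapsto h_y$, $\mathcal E_i\mapsto e_i$; an element $w$, with $w^*=w^{-1}$ on $\operatorname{Pic}$, sends the parameters to $\bar h_x=\iota^*(w^*\mathcal H_x)$, $\bar h_y=\iota^*(w^*\mathcal H_y)$, $\bar e_i=\iota^*(w^*\mathcal E_i)$. Consider the condition $$(\ast)\qquad e_1+e_2-e_5-e_6=0,\qquad e_3+e_4-e_7-e_8=0\qquad\text{in }\mathbb T .$$ Let $\Gamma$ be the subgroup of those $w\in W(E_8^{(1)})$ such that the new parameters satisfy $(\ast)$ if and only if the old ones do. Put $$\beta_0=\mathcal E_1-\mathcal E_2,\ \ \beta_1=\mathcal E_5-\mathcal E_6,\ \ \beta_2=\mathcal H_y-\mathcal E_1-\mathcal E_5,\ \ \beta_3=\mathcal H_x-\mathcal H_y,\ \ \beta_4=\mathcal H_y-\mathcal E_3-\mathcal E_7,\ \ \beta_5=\mathcal E_3-\mathcal E_4,\ \ \beta_6=\mathcal E_7-\mathcal E_8,$$ and let $\sigma_1=(\mathcal E_1\mathcal E_3\mathcal E_5\mathcal E_7)(\mathcal E_2\mathcal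 E_4\mathcal E_6\mathcal E_8)$ and $\sigma_2=(\mathcal E_1\mathcal E_5)(\mathcal E_2\mathcal E_6)$ act on $\operatorname{Pic}$ by permuting the $\mathcal E_i$ and fixing $\mathcal H_x,\mathcal H_y$. Then the following hold. 1. $\Gamma$ is generated by $w_{\beta_0},\dots,w_{\beta_6},\sigma_1,\sigma_2$. Moreover $w\in W(E_8^{(1)})$ already lies in $\Gamma$ if $w$ sends all parameters satisfying $(\ast)$ to parameters satisfying $(\ast)$, or if it does so for a single choice of parameters satisfying $(\ast)$ that is generic in the sense that $\iota^*\beta_0,\dots,\iota^*\beta_6$ are linearly independent over $\mathbb Z$; such generic parameters exist. 2. $\beta_0=\alpha_0$, $\beta_1=\alpha_6$, $\beta_2=\alpha_2+\alpha_3+\alpha_4+\alpha_5$, $\beta_3=\alpha_1$, $\beta_4=\alpha_0+\alpha_2+2\alpha_3+\alpha_4+\alpha_5+\alpha_6+\alpha_7$, $\beta_5=\alpha_4$, $\beta_6=\alpha_8$. The $\beta_i$ are linearly independent, and $(-\beta_i\bullet\beta_j)$ is the generalized Cartan matrix of type $D_6^{(1)}$, with diagram edges $02,12,23,34,45,46$.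 3. Let $W(D_6^{(1)})$ be the Weyl group of this matrix (generated by the fundamental reflections of the root lattice) and $\operatorname{Aut}(D_6^{(1)})$ the group of diagram automorphisms. Then $\Gamma$ is isomorphic to the extended affine Weyl group $\widetilde W(D_6^{(1)})=\operatorname{Aut}(D_6^{(1)})\ltimes W(D_6^{(1)})$, by an isomorphism that takes $w_{\beta_i}$ to the $i$-th fundamental reflection and $\sigma_1,\sigma_2$ to the diagram automorphisms $(0\,5\,1\,6)(2\,4)$ and $(0\,1)$; accordingly $\sigma_1=(\beta_0\beta_5\beta_1\beta_6)(\beta_2\beta_4)$ and $\sigma_2=(\beta_0\beta_1)$ on the $\beta_i$. The group $\operatorname{Aut}(D_6^{(1)})$ is the dihedral group of order $8$, $\langle\sigma_1,\sigma_2\mid\sigma_1^4=\sigma_2^2=(\sigma_2\sigma_1)^2=e\rangle$, and $\sigma_1^2$ exchanges $\beta_0$ with $\beta_1$ and $\beta_5$ with $\beta_6$. 4. Let $\varphi^*$ be the automorphism of $\operatorname{Pic}$ given by $\mathcal H_x\mapsto2\mathcal H_x+\mathcal H_y-\mathcal E_3-\mathcal E_4-\mathcal E_7-\mathcal E_8$,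 $\mathcal H_y\mapsto\mathcal H_x$, $\mathcal E_1\mapsto\mathcal H_x-\mathcal E_3$, $\mathcal E_2\mapsto\mathcal H_x-\mathcal E_4$, $\mathcal E_3\mapsto\mathcal E_2$, $\mathcal E_4\mapsto\mathcal E_1$, $\mathcal E_5\mapsto\mathcal H_x-\mathcal E_7$, $\mathcal E_6\mapsto\mathcal H_x-\mathcal E_8$, $\mathcal E_7\mapsto\mathcal E_6$, $\mathcal E_8\mapsto\mathcal E_5$, and put $\varphi_*=(\varphi^*)^{-1}$, $(\varphi^2)^*=(\varphi^*)^2$, $(\varphi^2)_*=(\varphi_*)^2$. Then $$\varphi^*:(\beta_0,\dots,\beta_6)\mapsto(-\beta_5,\,-\beta_6,\,-\beta_3-\beta_4,\,\beta_3+2\beta_4+\beta_5+\beta_6,\,\beta_0+\beta_1+\beta_2+\beta_3,\,-\beta_0,\,-\beta_1),$$ which is not a translation on $Q_B=\operatorname{Span}_{\mathbb Z}\{\beta_0,\dots,\beta_6\}$ (it does not move every element of $Q_B$ by an integer multiple of $\delta$), whereas $(\varphi^2)^*$ is a translation on $Q_B$, $$(\varphi^2)^*:(\beta_0,\dots,\beta_6)\mapsto(\beta_0,\dots,\beta_6)+(0,0,-1,1,0,0,0)\,\delta,\qquad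 \delta=\beta_0+\beta_1+2\beta_2+2\beta_3+2\beta_4+\beta_5+\beta_6 .$$ 5. With products read as compositions of maps from right to left and $w_i=w_{\beta_i}$, $$\varphi^*=\sigma_1^3w_6w_5w_3w_2w_1w_0w_2w_1w_0,\qquad(\varphi^2)^*=\sigma_1^2w_3w_4w_6w_5w_4w_3w_2w_1w_0w_2,$$ equivalently $$\varphi_*=w_0w_1w_2w_0w_1w_2w_3w_5w_6\,\sigma_1,\qquad(\varphi^2)_*=w_2w_0w_1w_2w_3w_4w_5w_6w_4w_3\,\sigma_1^2 .$$ -/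

import Mathlib

namespace EllipticD6

/-! ### The Picard lattice of `ℙ¹ × ℙ¹` blown up at eight points -/

/-- `Pic(𝓧) = ℤ 𝓗_x ⊕ ℤ 𝓗_y ⊕ ℤ 𝓔₁ ⊕ ⋯ ⊕ ℤ 𝓔₈`, in coordinates. -/
abbrev Pic : Type := Fin 2 ⊕ Fin 8 → ℤ

/-- The class `𝓗_x` of vertical lines. -/
def Hx : Pic := Pi.single (Sum.inl 0) 1

/-- The class `𝓗_y` of horizontal lines. -/
def Hy : Pic := Pi.single (Sum.inl 1) 1

/-- The exceptional classes; `E k` is `𝓔_{k+1}`, so that `E 0, …, E 7` are `𝓔₁, …, 𝓔₈`. -/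
def E (k : Fin 8) : Pic := Pi.single (Sum.inr k) 1

/-- The intersection form: `𝓗_x • 𝓗_y = 1`, `𝓔_i • 𝓔_j = -δ_{ij}`, other products of the
basis classes vanish. -/
def inter : LinearMap.BilinForm ℤ Pic :=
  LinearMap.mk₂ ℤ
    (fun D D' => D (Sum.inl 0) * D' (Sum.inl 1) + D (Sum.inl 1) * D' (Sum.inl 0)
      - ∑ k : Fin 8, D (Sum.inr k) * D' (Sum.inr k))
    (by intro a b c; simp [add_mul, Finset.sum_add_distrib]; ring)
    (by intro r a b; simp [mul_assoc, ← Finset.mul_sum]; ring)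
    (by intro a b c; simp [mul_add, Finset.sum_add_distrib]; ring)
    (by
      intro r a b
      simp only [Pi.smul_apply, smul_eq_mul, mul_left_comm _ r _, ← Finset.mul_sum]
      ring)

/-- The class `δ = -K = 2𝓗_x + 2𝓗_y - 𝓔₁ - ⋯ - 𝓔₈` of the anti-canonical divisor. -/
def delta : Pic := (2 : ℤ) • Hx + (2 : ℤ) • Hy - ∑ k : Fin 8, E k

/-- The reflection `D ↦ D + (a • D) a` in a class `a` with `a • a = -2`. -/
def refl (a : Pic) (h : inter a a = -2) : Pic ≃ₗ[ℤ] Pic :=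
  Module.reflection (x := a) (f := -(inter a)) (by simp [h])

theorem refl_apply (a : Pic) (h : inter a a = -2) (D : Pic) :
    refl a h D = D + inter a D • a := by
  simp [refl, Module.reflection_apply]

/-! ### The affine Weyl group of type `E₈⁽¹⁾` -/

/-- The simple roots `α₀, …, α₈` of type `E₈⁽¹⁾`. -/
def alpha : Fin 9 → Pic :=
  ![E 0 - E 1, Hx - Hy, Hy - E 0 - E 1, E 1 - E 2, E 2 - E 3, E 3 - E 4, E 4 - E 5, E 5 - E 6,
    E 6 - E 7]

theorem alpha_sq (i : Fin 9) : inter (alpha i) (alpha i) = -2 := by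
  revert i; decide

/-- `W(E₈⁽¹⁾)`, acting on `Pic(𝓧)`: the group generated by the reflections in `α₀, …, α₈`. -/
def weylE8 : Subgroup (Pic ≃ₗ[ℤ] Pic) :=
  Subgroup.closure (Set.range fun i => refl (alpha i) (alpha_sq i))

/-! ### Parameters on the elliptic curve and the constraint -/

/-- The elliptic curve `𝕋 = ℂ / (ℤ + ℤ τ)`, identified with its Picard group in which the class
of a point is that point. -/
abbrev Torus (τ : ℂ) : Type := ℂ ⧸ AddSubgroup.closure ({1, τ} : Set ℂ)

/-- The parameters `h_x, h_y, e₁, …, e₈`, points of a group `T`; `e k` is `e_{k+1}`. -/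
structure Parameters (T : Type*) where
  hx : T
  hy : T
  e : Fin 8 → T

namespace Parameters

variable {T : Type*} [AddCommGroup T]

/-- The pull-back `ι^* : Pic(𝓧) → 𝕋`, the homomorphism with `𝓗_x ↦ h_x`, `𝓗_y ↦ h_y`,
`𝓔_i ↦ e_i`. -/
def pullback (p : Parameters T) : Pic →ₗ[ℤ] T :=
  Fintype.linearCombination ℤ (Sum.elim ![p.hx, p.hy] p.e)

/-- The evolution of the parameters under `w`. Here `w` stands for the push-forward action `w_*`
on the Picard lattice, so that the pull-back action `w^*` is its inverse, and the new parameters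
are `h̄_x = ι^*(w^* 𝓗_x)`, `h̄_y = ι^*(w^* 𝓗_y)`, `ē_i = ι^*(w^* 𝓔_i)`. -/
def evolve (p : Parameters T) (w : Pic ≃ₗ[ℤ] Pic) : Parameters T where
  hx := p.pullback (w⁻¹ Hx)
  hy := p.pullback (w⁻¹ Hy)
  e := fun k => p.pullback (w⁻¹ (E k))

/-- The condition `e₁ + e₂ - e₅ - e₆ = 0`, `e₃ + e₄ - e₇ - e₈ = 0`. -/
def Constraint (p : Parameters T) : Prop :=
  p.e 0 + p.e 1 - p.e 4 - p.e 5 = 0 ∧ p.e 2 + p.e 3 - p.e 6 - p.e 7 = 0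

theorem pullback_Hx (p : Parameters T) : p.pullback Hx = p.hx := by
  simp [pullback, Hx, Fintype.linearCombination_apply_single]

theorem pullback_Hy (p : Parameters T) : p.pullback Hy = p.hy := by
  simp [pullback, Hy, Fintype.linearCombination_apply_single]

theorem pullback_E (p : Parameters T) (k : Fin 8) : p.pullback (E k) = p.e k := by
  simp [pullback, E, Fintype.linearCombination_apply_single]

theorem pullback_evolve (p : Parameters T) (w : Pic ≃ₗ[ℤ] Pic) (D : Pic) :
    (p.evolve w).pullback D = p.pullback (w⁻¹ D) := by
  have h : (p.evolve w).pullback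
      = p.pullback ∘ₗ ((w⁻¹ : Pic ≃ₗ[ℤ] Pic) : Pic →ₗ[ℤ] Pic) := by
    refine (Pi.basisFun ℤ (Fin 2 ⊕ Fin 8)).ext fun i => ?_
    rw [Pi.basisFun_apply]
    rcases i with i | k
    · fin_cases i
      · exact pullback_Hx _
      · exact pullback_Hy _
    · exact pullback_E _ k
  rw [h]; rfl

theorem evolve_one (p : Parameters T) : p.evolve 1 = p := by
  cases p with
  | mk hx hy e =>
    simp only [evolve, inv_one, LinearEquiv.coe_one, id_eq, pullback_Hx, pullback_Hy, pullback_E]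

theorem evolve_mul (p : Parameters T) (v w : Pic ≃ₗ[ℤ] Pic) :
    p.evolve (v * w) = (p.evolve w).evolve v := by
  have key : ∀ D, p.pullback ((v * w)⁻¹ D) = (p.evolve w).pullback (v⁻¹ D) := by
    intro D; rw [pullback_evolve, mul_inv_rev]; rfl
  simp only [evolve, Parameters.mk.injEq]
  exact ⟨key _, key _, funext fun k => key _⟩

end Parameters

/-- The elements of `W(E₈⁽¹⁾)` that preserve the constraint: a point of the parameter space
satisfies the constraint if and only if its image does. -/
def preservingSubgroup (τ : ℂ) : Subgroup (Pic ≃ₗ[ℤ] Pic) where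
  carrier := {w | w ∈ weylE8 ∧
    ∀ p : Parameters (Torus τ), (p.evolve w).Constraint ↔ p.Constraint}
  one_mem' := ⟨weylE8.one_mem, fun p => by rw [Parameters.evolve_one]⟩
  mul_mem' := by
    rintro v w ⟨hv, hv'⟩ ⟨hw, hw'⟩
    exact ⟨weylE8.mul_mem hv hw, fun p => by rw [Parameters.evolve_mul, hv', hw']⟩
  inv_mem' := by
    rintro w ⟨hw, hw'⟩
    refine ⟨weylE8.inv_mem hw, fun p => ?_⟩
    rw [← hw' (p.evolve w⁻¹), ← Parameters.evolve_mul, mul_inv_cancel, Parameters.evolve_one]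

/-! ### The roots `β₀, …, β₆` and the automorphisms `σ₁, σ₂` -/

/-- The roots `β₀, …, β₆`. -/
def beta : Fin 7 → Pic :=
  ![E 0 - E 1, E 4 - E 5, Hy - E 0 - E 4, Hx - Hy, Hy - E 2 - E 6, E 2 - E 3, E 6 - E 7]

theorem beta_sq (i : Fin 7) : inter (beta i) (beta i) = -2 := by
  revert i; decide

/-- The reflection `w_{β_i}` of `Pic(𝓧)`. -/
def wBeta (i : Fin 7) : Pic ≃ₗ[ℤ] Pic := refl (beta i) (beta_sq i)

/-- The sublattice `Q_B` spanned by `β₀, …, β₆`. -/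
def latticeB : Submodule ℤ Pic := Submodule.span ℤ (Set.range beta)

/-- The parameters are generic for the constrained family when `ι^* β₀, …, ι^* β₆` are linearly
independent over `ℤ`. -/
def Parameters.IsGeneric {T : Type*} [AddCommGroup T] (p : Parameters T) : Prop :=
  LinearIndependent ℤ fun i : Fin 7 => p.pullback (beta i)

/-- The automorphism of `Pic(𝓧)` that fixes `𝓗_x, 𝓗_y` and permutes the exceptional classes by
`E k ↦ E (π k)`. -/
def permE (π : Equiv.Perm (Fin 8)) : Pic ≃ₗ[ℤ] Pic :=
  LinearEquiv.funCongrLeft ℤ ℤ (Equiv.sumCongr (Equiv.refl (Fin 2)) π).symm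

/-- `σ₁ = (𝓔₁ 𝓔₃ 𝓔₅ 𝓔₇)(𝓔₂ 𝓔₄ 𝓔₆ 𝓔₈)`. -/
def sigma1 : Pic ≃ₗ[ℤ] Pic := permE (c[0, 2, 4, 6] * c[1, 3, 5, 7])

/-- `σ₂ = (𝓔₁ 𝓔₅)(𝓔₂ 𝓔₆)`. -/
def sigma2 : Pic ≃ₗ[ℤ] Pic := permE (c[0, 4] * c[1, 5])

/-- An endomorphism acts as a translation on a sublattice `L` when it moves every element of `L`
by an integer multiple of `δ`. -/
def IsTranslationOn (L : Submodule ℤ Pic) (f : Pic ≃ₗ[ℤ] Pic) : Prop :=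
  ∀ x ∈ L, ∃ n : ℤ, f x = x + n • delta

/-! ### The action of the mapping `φ` -/

/-- The images of `𝓗_x, 𝓗_y, 𝓔₁, …, 𝓔₈` under `φ_*`. -/
def phiPushImages : Fin 2 ⊕ Fin 8 → Pic :=
  Sum.elim ![Hy, Hx + (2 : ℤ) • Hy - E 0 - E 1 - E 4 - E 5]
    ![E 3, E 2, Hy - E 0, Hy - E 1, E 7, E 6, Hy - E 4, Hy - E 5]

/-- The images of `𝓗_x, 𝓗_y, 𝓔₁, …, 𝓔₈` under `φ^*`. -/
def phiPullImages : Fin 2 ⊕ Fin 8 → Pic :=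
  Sum.elim ![(2 : ℤ) • Hx + Hy - E 2 - E 3 - E 6 - E 7, Hx]
    ![Hx - E 2, Hx - E 3, E 1, E 0, Hx - E 6, Hx - E 7, E 5, E 4]

/-- The push-forward action `φ_*` on `Pic(𝓧)`. -/
def phiPush : Pic ≃ₗ[ℤ] Pic :=
  LinearEquiv.ofLinearMap (Fintype.linearCombination ℤ phiPushImages)
    (Fintype.linearCombination ℤ phiPullImages)
    (by
      refine (Pi.basisFun ℤ (Fin 2 ⊕ Fin 8)).ext fun i => ?_
      rw [Pi.basisFun_apply, LinearMap.comp_apply, Fintype.linearCombination_apply_single,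
        one_smul, LinearMap.id_apply, Fintype.linearCombination_apply]
      revert i; decide)
    (by
      refine (Pi.basisFun ℤ (Fin 2 ⊕ Fin 8)).ext fun i => ?_
      rw [Pi.basisFun_apply, LinearMap.comp_apply, Fintype.linearCombination_apply_single,
        one_smul, LinearMap.id_apply, Fintype.linearCombination_apply]
      revert i; decide)

/-- The pull-back action `φ^* = (φ_*)⁻¹` on `Pic(𝓧)`. -/
def phiPull : Pic ≃ₗ[ℤ] Pic := phiPush⁻¹

theorem phiPull_apply (D : Pic) : phiPull D = Fintype.linearCombination ℤ phiPullImages D := rfl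

/-! ### The extended affine Weyl group of type `D₆⁽¹⁾` -/

/-- The generalized Cartan matrix of type `D₆⁽¹⁾`, for the Dynkin diagram with the edges
`0 — 2`, `1 — 2`, `2 — 3`, `3 — 4`, `4 — 5`, `4 — 6`. -/
def cartanD6 : Matrix (Fin 7) (Fin 7) ℤ :=
  !![ 2,  0, -1,  0,  0,  0,  0;
      0,  2, -1,  0,  0,  0,  0;
     -1, -1,  2, -1,  0,  0,  0;
      0,  0, -1,  2, -1,  0,  0;
      0,  0,  0, -1,  2, -1, -1;
      0,  0,  0,  0, -1,  2,  0;
      0,  0,  0,  0, -1,  0,  2]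

/-- The abstract root lattice of type `D₆⁽¹⁾`, free on the simple roots `Pi.single i 1`. -/
abbrev RootLatticeD6 : Type := Fin 7 → ℤ

/-- The `i`-th fundamental reflection `a_j ↦ a_j - A_{ij} a_i` of the abstract root lattice. -/
def simpleReflD6 (i : Fin 7) : RootLatticeD6 ≃ₗ[ℤ] RootLatticeD6 :=
  Module.reflection (x := Pi.single i 1) (f := Fintype.linearCombination ℤ (cartanD6 i))
    (by rw [Fintype.linearCombination_apply_single, one_smul]; revert i; decide)

/-- The affine Weyl group `W(D₆⁽¹⁾)`, generated by the fundamental reflections. -/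
def weylD6 : Subgroup (RootLatticeD6 ≃ₗ[ℤ] RootLatticeD6) :=
  Subgroup.closure (Set.range simpleReflD6)

/-- `Aut(D₆⁽¹⁾)`: the permutations of the simple roots that preserve the Cartan matrix, i.e. the
automorphisms of the Dynkin diagram. -/
def autD6 : Subgroup (Equiv.Perm (Fin 7)) where
  carrier := {π | ∀ i j, cartanD6 (π i) (π j) = cartanD6 i j}
  one_mem' := fun _ _ => rfl
  mul_mem' := by
    intro π ρ hπ hρ i j
    rw [Equiv.Perm.mul_apply, Equiv.Perm.mul_apply, hπ, hρ]
  inv_mem' := by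
    intro π hπ i j
    rw [← hπ (π⁻¹ i) (π⁻¹ j), ← Equiv.Perm.mul_apply, ← Equiv.Perm.mul_apply, mul_inv_cancel,
      Equiv.Perm.one_apply, Equiv.Perm.one_apply]

/-- A permutation of the simple roots, extended linearly to the root lattice: `a_i ↦ a_{π i}`. -/
def permLattice : Equiv.Perm (Fin 7) →* (RootLatticeD6 ≃ₗ[ℤ] RootLatticeD6) where
  toFun π := LinearEquiv.funCongrLeft ℤ ℤ π.symm
  map_one' := rfl
  map_mul' _ _ := rfl

theorem permLattice_conj (π : autD6) (i : Fin 7) :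
    permLattice π * simpleReflD6 i * (permLattice π)⁻¹ = simpleReflD6 (π.1 i) := by
  rw [mul_inv_eq_iff_eq_mul]
  refine LinearEquiv.toLinearMap_injective ((Pi.basisFun ℤ (Fin 7)).ext fun j => ?_)
  have hp : ∀ k, permLattice π (Pi.single k 1) = Pi.single (π.1 k) 1 := by
    intro k
    ext l
    simp [permLattice, LinearEquiv.funCongrLeft, LinearMap.funLeft, Pi.single_apply,
      Equiv.symm_apply_eq]
  simp only [LinearEquiv.coe_coe, Pi.basisFun_apply, LinearEquiv.mul_apply, simpleReflD6,
    Module.reflection_apply, map_sub, map_smul, hp, Fintype.linearCombination_apply_single,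
    one_smul, π.2 i j]

theorem permLattice_mem_normalizer (π : autD6) :
    permLattice π ∈ Subgroup.normalizer (weylD6 : Set (RootLatticeD6 ≃ₗ[ℤ] RootLatticeD6)) := by
  have key : ∀ (ρ : autD6), ∀ w ∈ weylD6, permLattice ρ * w * (permLattice ρ)⁻¹ ∈ weylD6 := by
    intro ρ w hw
    have : weylD6 ≤ weylD6.comap (MulAut.conj (permLattice ρ)).toMonoidHom := by
      conv_lhs => rw [weylD6]
      rw [Subgroup.closure_le]
      rintro _ ⟨i, rfl⟩
      show permLattice ρ * simpleReflD6 i * (permLattice ρ)⁻¹ ∈ weylD6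
      rw [permLattice_conj]
      exact Subgroup.subset_closure ⟨_, rfl⟩
    exact this hw
  rw [Subgroup.mem_normalizer_iff]
  intro w
  refine ⟨key π w, fun h => ?_⟩
  have := key π⁻¹ _ h
  simpa [mul_assoc] using this

/-- The action of `Aut(D₆⁽¹⁾)` on `W(D₆⁽¹⁾)`, by conjugation. -/
def autAction : autD6 →* MulAut weylD6 :=
  weylD6.normalizerMonoidHom.comp
    ((permLattice.comp autD6.subtype).codRestrict _ permLattice_mem_normalizer)

/-- The extended affine Weyl group `W̃(D₆⁽¹⁾) = Aut(D₆⁽¹⁾) ⋉ W(D₆⁽¹⁾)`. -/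
abbrev ExtendedWeylD6 : Type := weylD6 ⋊[autAction] autD6

/-- The generator of `W(D₆⁽¹⁾) ≤ W̃(D₆⁽¹⁾)` at the node `i`. -/
def simpleGen (i : Fin 7) : ExtendedWeylD6 :=
  SemidirectProduct.inl ⟨simpleReflD6 i, Subgroup.subset_closure ⟨i, rfl⟩⟩

/-- The permutation `(0 5 1 6)(2 4)` of the nodes of the Dynkin diagram. -/
def perm1 : Equiv.Perm (Fin 7) := c[0, 5, 1, 6] * c[2, 4]

/-- The permutation `(0 1)` of the nodes of the Dynkin diagram. -/
def perm2 : Equiv.Perm (Fin 7) := c[0, 1]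

theorem perm1_mem (i j : Fin 7) : cartanD6 (perm1 i) (perm1 j) = cartanD6 i j := by
  revert j; fin_cases i <;> decide

theorem perm2_mem (i j : Fin 7) : cartanD6 (perm2 i) (perm2 j) = cartanD6 i j := by
  revert j; fin_cases i <;> decide

/-- The diagram automorphism `(β₀ β₅ β₁ β₆)(β₂ β₄)`. -/
def diagram1 : autD6 := ⟨perm1, perm1_mem⟩

/-- The diagram automorphism `(β₀ β₁)`. -/
def diagram2 : autD6 := ⟨perm2, perm2_mem⟩

/-- The relators `s₁⁴`, `s₂²`, `(s₂ s₁)²` in the free group on two letters `s₁, s₂`. -/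
def dihedralRelators : Set (FreeGroup (Fin 2)) :=
  {FreeGroup.of 0 ^ 4, FreeGroup.of 1 ^ 2, (FreeGroup.of 1 * FreeGroup.of 0) ^ 2}

end EllipticD6

/-! Write A, B for the classes `clsA`, `clsB` whose pull-backs vanish under the constraint. They are
orthogonal of square -4, and the `beta i` span their common orthogonal complement inside the
complement of `delta`. If `p` is generic and satisfies the constraint, the kernel of its pull-back
on the complement of `delta` is exactly the span of A and B. So if `w` is an isometry fixing `delta`
that keeps one such point in the constrained family, `w⁻¹` maps A and B to orthogonal vectors of
square -4 in that span, that is, to A and B up to order and sign (`preservesSpan_of_isGeneric`). The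
eight signed permutations are realised by words in `sigma1`, `sigma2`, and every element inducing
one preserves the constraint at all parameters.

This reduces the generation statement to isometries fixing `delta`, A and B, which must be products
of the reflections `wBeta` (`pointwiseFixer_eq`). The argument is the classical one with a Weyl
vector ρ, here `clsRho`. Negative semidefiniteness on the complement of `delta` bounds the product
of gρ with ρ from below, so reflections make gρ dominant. Roots are positive or negative, and the
coefficients of `delta` have sum 10, the product of `delta` with ρ; hence the dominant element
permutes the simple roots. What remains is a diagram automorphism fixing A and B. It is trivial by
divisibility by 2 and 4 in the Picard lattice (`permutation_eq_id`), and an isometry fixing `delta`,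
A, B and all `beta i` is the identity (`eq_one_of_fixes`).

For the isomorphism, elements of the extended Weyl group and of the preserving subgroup are matched
when they act compatibly on the root lattice (`Extends`). Both actions are faithful, again by
divisibility. The words for φ are coordinate identities. -/

namespace EllipticD6

/-! ### Coordinates on the Picard lattice -/

/-- The class with the given coordinates. -/
def vec (x y a b c d e f g h : ℤ) : Pic := Sum.elim ![x, y] ![a, b, c, d, e, f, g, h]

theorem exists_vec (D : Pic) : ∃ x y a b c d e f g h, D = vec x y a b c d e f g h := by
  refine ⟨D (.inl 0), D (.inl 1), D (.inr 0), D (.inr 1), D (.inr 2), D (.inr 3), D (.inr 4),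
    D (.inr 5), D (.inr 6), D (.inr 7), ?_⟩
  ext i
  rcases i with i | i <;> fin_cases i <;> rfl

theorem vec_inj {x y a b c d e f g h x' y' a' b' c' d' e' f' g' h' : ℤ} :
    vec x y a b c d e f g h = vec x' y' a' b' c' d' e' f' g' h' ↔
      x = x' ∧ y = y' ∧ a = a' ∧ b = b' ∧ c = c' ∧ d = d' ∧ e = e' ∧ f = f' ∧ g = g' ∧ h = h' := by
  constructor
  · intro H
    exact ⟨congrFun H (.inl 0), congrFun H (.inl 1), congrFun H (.inr 0), congrFun H (.inr 1),
      congrFun H (.inr 2), congrFun H (.inr 3), congrFun H (.inr 4), congrFun H (.inr 5),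
      congrFun H (.inr 6), congrFun H (.inr 7)⟩
  · rintro ⟨rfl, rfl, rfl, rfl, rfl, rfl, rfl, rfl, rfl, rfl⟩; rfl

theorem vec_add (x y a b c d e f g h x' y' a' b' c' d' e' f' g' h' : ℤ) :
    vec x y a b c d e f g h + vec x' y' a' b' c' d' e' f' g' h' =
      vec (x + x') (y + y') (a + a') (b + b') (c + c') (d + d') (e + e') (f + f') (g + g')
        (h + h') := by
  ext i; rcases i with i | i <;> fin_cases i <;> rfl

theorem vec_sub (x y a b c d e f g h x' y' a' b' c' d' e' f' g' h' : ℤ) :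
    vec x y a b c d e f g h - vec x' y' a' b' c' d' e' f' g' h' =
      vec (x - x') (y - y') (a - a') (b - b') (c - c') (d - d') (e - e') (f - f') (g - g')
        (h - h') := by
  ext i; rcases i with i | i <;> fin_cases i <;> rfl

theorem vec_neg (x y a b c d e f g h : ℤ) :
    -vec x y a b c d e f g h = vec (-x) (-y) (-a) (-b) (-c) (-d) (-e) (-f) (-g) (-h) := by
  ext i; rcases i with i | i <;> fin_cases i <;> rfl

theorem vec_smul (n x y a b c d e f g h : ℤ) :
    n • vec x y a b c d e f g h =
      vec (n * x) (n * y) (n * a) (n * b) (n * c) (n * d) (n * e) (n * f) (n * g) (n * h) := by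
  ext i; rcases i with i | i <;> fin_cases i <;> rfl

theorem inter_vec (x y a b c d e f g h x' y' a' b' c' d' e' f' g' h' : ℤ) :
    inter (vec x y a b c d e f g h) (vec x' y' a' b' c' d' e' f' g' h') =
      x * y' + y * x' - (a * a' + b * b' + c * c' + d * d' + e * e' + f * f' + g * g' + h * h') := by
  simp only [inter, LinearMap.mk₂_apply, Fin.sum_univ_eight]
  rfl

theorem inter_comm (D D' : Pic) : inter D D' = inter D' D := by
  obtain ⟨x, y, a, b, c, d, e, f, g, h, rfl⟩ := exists_vec D
  obtain ⟨x', y', a', b', c', d', e', f', g', h', rfl⟩ := exists_vec D'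
  rw [inter_vec, inter_vec]; ring

theorem delta_eq : delta = vec 2 2 (-1) (-1) (-1) (-1) (-1) (-1) (-1) (-1) := by decide

theorem beta_zero : beta 0 = vec 0 0 1 (-1) 0 0 0 0 0 0 := by decide
theorem beta_one : beta 1 = vec 0 0 0 0 0 0 1 (-1) 0 0 := by decide
theorem beta_two : beta 2 = vec 0 1 (-1) 0 0 0 (-1) 0 0 0 := by decide
theorem beta_three : beta 3 = vec 1 (-1) 0 0 0 0 0 0 0 0 := by decide
theorem beta_four : beta 4 = vec 0 1 0 0 (-1) 0 0 0 (-1) 0 := by decide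
theorem beta_five : beta 5 = vec 0 0 0 0 1 (-1) 0 0 0 0 := by decide
theorem beta_six : beta 6 = vec 0 0 0 0 0 0 0 0 1 (-1) := by decide

/-- The class `𝓔₁ + 𝓔₂ - 𝓔₅ - 𝓔₆`. -/
def clsA : Pic := vec 0 0 1 1 0 0 (-1) (-1) 0 0

/-- The class `𝓔₃ + 𝓔₄ - 𝓔₇ - 𝓔₈`. -/
def clsB : Pic := vec 0 0 0 0 1 1 0 0 (-1) (-1)

section Action

variable (x y a b c d e f g h : ℤ)

theorem wBeta_apply (i : Fin 7) (D : Pic) : wBeta i D = D + inter (beta i) D • beta i :=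
  refl_apply _ _ _

theorem wBeta_zero_vec : wBeta 0 (vec x y a b c d e f g h) = vec x y b a c d e f g h := by
  rw [wBeta_apply, beta_zero, inter_vec, vec_smul, vec_add, vec_inj]
  refine ⟨?_, ?_, ?_, ?_, ?_, ?_, ?_, ?_, ?_, ?_⟩ <;> ring

theorem wBeta_one_vec : wBeta 1 (vec x y a b c d e f g h) = vec x y a b c d f e g h := by
  rw [wBeta_apply, beta_one, inter_vec, vec_smul, vec_add, vec_inj]
  refine ⟨?_, ?_, ?_, ?_, ?_, ?_, ?_, ?_, ?_, ?_⟩ <;> ring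

theorem wBeta_two_vec : wBeta 2 (vec x y a b c d e f g h) =
    vec x (y + x + a + e) (-x - e) b c d (-x - a) f g h := by
  rw [wBeta_apply, beta_two, inter_vec, vec_smul, vec_add, vec_inj]
  refine ⟨?_, ?_, ?_, ?_, ?_, ?_, ?_, ?_, ?_, ?_⟩ <;> ring

theorem wBeta_three_vec : wBeta 3 (vec x y a b c d e f g h) = vec y x a b c d e f g h := by
  rw [wBeta_apply, beta_three, inter_vec, vec_smul, vec_add, vec_inj]
  refine ⟨?_, ?_, ?_, ?_, ?_, ?_, ?_, ?_, ?_, ?_⟩ <;> ring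

theorem wBeta_four_vec : wBeta 4 (vec x y a b c d e f g h) =
    vec x (y + x + c + g) a b (-x - g) d e f (-x - c) h := by
  rw [wBeta_apply, beta_four, inter_vec, vec_smul, vec_add, vec_inj]
  refine ⟨?_, ?_, ?_, ?_, ?_, ?_, ?_, ?_, ?_, ?_⟩ <;> ring

theorem wBeta_five_vec : wBeta 5 (vec x y a b c d e f g h) = vec x y a b d c e f g h := by
  rw [wBeta_apply, beta_five, inter_vec, vec_smul, vec_add, vec_inj]
  refine ⟨?_, ?_, ?_, ?_, ?_, ?_, ?_, ?_, ?_, ?_⟩ <;> ring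

theorem wBeta_six_vec : wBeta 6 (vec x y a b c d e f g h) = vec x y a b c d e f h g := by
  rw [wBeta_apply, beta_six, inter_vec, vec_smul, vec_add, vec_inj]
  refine ⟨?_, ?_, ?_, ?_, ?_, ?_, ?_, ?_, ?_, ?_⟩ <;> ring

theorem sigma1_vec : sigma1 (vec x y a b c d e f g h) = vec x y g h a b c d e f := by
  ext i
  rcases i with i | i <;> fin_cases i <;> rfl

theorem phiPull_vec : phiPull (vec x y a b c d e f g h) =
    vec (2 * x + y + a + b + e + f) x d c (-x - a) (-x - b) h g (-x - e) (-x - f) := by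
  rw [phiPull_apply, Fintype.linearCombination_apply, Fintype.sum_sum_type, Fin.sum_univ_two,
    Fin.sum_univ_eight]
  ext i
  rcases i with i | i <;> fin_cases i <;>
    simp [phiPullImages, vec, Hx, Hy, E] <;> ring

theorem phiPush_vec : phiPush (vec x y a b c d e f g h) =
    vec y (x + 2 * y + c + d + g + h) (-y - c) (-y - d) b a (-y - g) (-y - h) f e := by
  refine phiPull.injective ?_
  rw [phiPull_vec]
  change phiPush.symm (phiPush _) = _
  rw [LinearEquiv.symm_apply_apply, vec_inj]
  refine ⟨?_, ?_, ?_, ?_, ?_, ?_, ?_, ?_, ?_, ?_⟩ <;> ring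

end Action

theorem equiv_ext_vec {v w : Pic ≃ₗ[ℤ] Pic} (H : ∀ x y a b c d e f g h : ℤ,
    v (vec x y a b c d e f g h) = w (vec x y a b c d e f g h)) : v = w := by
  ext1 D
  obtain ⟨x, y, a, b, c, d, e, f, g, h, rfl⟩ := exists_vec D
  exact H ..

/-! ### Words for φ and its action on the simple roots -/

theorem phiPull_word : phiPull = sigma1 ^ 3 * wBeta 6 * wBeta 5 * wBeta 3 * wBeta 2 * wBeta 1 *
    wBeta 0 * wBeta 2 * wBeta 1 * wBeta 0 := by
  refine equiv_ext_vec fun x y a b c d e f g h => ?_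
  simp only [pow_succ, pow_zero, one_mul, LinearEquiv.mul_apply, wBeta_zero_vec, wBeta_one_vec,
    wBeta_two_vec, wBeta_three_vec, wBeta_five_vec, wBeta_six_vec, sigma1_vec, phiPull_vec, vec_inj]
  refine ⟨?_, ?_, ?_, ?_, ?_, ?_, ?_, ?_, ?_, ?_⟩ <;> first | trivial | ring

theorem phiPull_sq_word : phiPull ^ 2 = sigma1 ^ 2 * wBeta 3 * wBeta 4 * wBeta 6 * wBeta 5 *
    wBeta 4 * wBeta 3 * wBeta 2 * wBeta 1 * wBeta 0 * wBeta 2 := by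
  refine equiv_ext_vec fun x y a b c d e f g h => ?_
  simp only [pow_succ, pow_zero, one_mul, LinearEquiv.mul_apply, wBeta_zero_vec, wBeta_one_vec,
    wBeta_two_vec, wBeta_three_vec, wBeta_four_vec, wBeta_five_vec, wBeta_six_vec, sigma1_vec,
    phiPull_vec, vec_inj]
  refine ⟨?_, ?_, ?_, ?_, ?_, ?_, ?_, ?_, ?_, ?_⟩ <;> first | trivial | ring

theorem phiPush_word : phiPush = wBeta 0 * wBeta 1 * wBeta 2 * wBeta 0 * wBeta 1 * wBeta 2 *
    wBeta 3 * wBeta 5 * wBeta 6 * sigma1 := by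
  refine equiv_ext_vec fun x y a b c d e f g h => ?_
  simp only [LinearEquiv.mul_apply, wBeta_zero_vec, wBeta_one_vec, wBeta_two_vec,
    wBeta_three_vec, wBeta_five_vec, wBeta_six_vec, sigma1_vec, phiPush_vec, vec_inj]
  refine ⟨?_, ?_, ?_, ?_, ?_, ?_, ?_, ?_, ?_, ?_⟩ <;> first | trivial | ring

theorem phiPush_sq_word : phiPush ^ 2 = wBeta 2 * wBeta 0 * wBeta 1 * wBeta 2 * wBeta 3 *
    wBeta 4 * wBeta 5 * wBeta 6 * wBeta 4 * wBeta 3 * sigma1 ^ 2 := by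
  refine equiv_ext_vec fun x y a b c d e f g h => ?_
  simp only [pow_succ, pow_zero, one_mul, LinearEquiv.mul_apply, wBeta_zero_vec, wBeta_one_vec,
    wBeta_two_vec, wBeta_three_vec, wBeta_four_vec, wBeta_five_vec, wBeta_six_vec, sigma1_vec,
    phiPush_vec, vec_inj]
  refine ⟨?_, ?_, ?_, ?_, ?_, ?_, ?_, ?_, ?_, ?_⟩ <;> first | trivial | ring

theorem delta_eq_beta : delta = beta 0 + beta 1 + (2 : ℤ) • beta 2 + (2 : ℤ) • beta 3 +
    (2 : ℤ) • beta 4 + beta 5 + beta 6 := by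
  decide

theorem beta_eq_alpha :
    beta 0 = alpha 0 ∧ beta 1 = alpha 6 ∧
      beta 2 = alpha 2 + alpha 3 + alpha 4 + alpha 5 ∧ beta 3 = alpha 1 ∧
      beta 4 = alpha 0 + alpha 2 + (2 : ℤ) • alpha 3 + alpha 4 + alpha 5 + alpha 6 + alpha 7 ∧
      beta 5 = alpha 4 ∧ beta 6 = alpha 8 := by
  refine ⟨?_, ?_, ?_, ?_, ?_, ?_, ?_⟩ <;> decide

theorem inter_beta (i j : Fin 7) : inter (beta i) (beta j) = -cartanD6 i j := by
  revert i j; decide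

theorem sigma1_beta (i : Fin 7) : sigma1 (beta i) = beta (perm1 i) := by
  fin_cases i <;> decide

theorem sigma2_beta (i : Fin 7) : sigma2 (beta i) = beta (perm2 i) := by
  fin_cases i <;> decide

theorem phiPull_beta : phiPull (beta 0) = -beta 5 ∧ phiPull (beta 1) = -beta 6 ∧
    phiPull (beta 2) = -beta 3 - beta 4 ∧
    phiPull (beta 3) = beta 3 + (2 : ℤ) • beta 4 + beta 5 + beta 6 ∧
    phiPull (beta 4) = beta 0 + beta 1 + beta 2 + beta 3 ∧
    phiPull (beta 5) = -beta 0 ∧ phiPull (beta 6) = -beta 1 := by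
  simp only [beta_zero, beta_one, beta_two, beta_three, beta_four, beta_five, beta_six,
    phiPull_vec, vec_neg, vec_sub, vec_add, vec_smul, vec_inj]
  norm_num

theorem phiPull_sq_beta (i : Fin 7) : (phiPull ^ 2) (beta i) =
    beta i + (![0, 0, -1, 1, 0, 0, 0] : Fin 7 → ℤ) i • delta := by
  rw [pow_two, LinearEquiv.mul_apply]
  fin_cases i <;>
    simp [beta_zero, beta_one, beta_two, beta_three, beta_four, beta_five, beta_six, delta_eq,
      phiPull_vec, vec_neg, vec_add]

theorem phiPull_not_isTranslationOn : ¬ IsTranslationOn latticeB phiPull := by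
  intro H
  obtain ⟨n, hn⟩ := H (beta 0) (Submodule.subset_span ⟨0, rfl⟩)
  -- The coefficient of `Hx` forces `n = 0`, but `beta 0` is not fixed.
  rw [beta_zero, delta_eq, phiPull_vec, vec_smul, vec_add, vec_inj] at hn
  omega

theorem phiPull_sq_isTranslationOn : IsTranslationOn latticeB (phiPull ^ 2) := by
  intro x hx
  induction hx using Submodule.span_induction with
  | mem x h => obtain ⟨i, rfl⟩ := h; exact ⟨_, phiPull_sq_beta i⟩
  | zero => exact ⟨0, by simp⟩
  | add x y _ _ hx hy =>
    obtain ⟨m, hm⟩ := hx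
    obtain ⟨n, hn⟩ := hy
    exact ⟨m + n, by rw [map_add, hm, hn, add_smul]; abel⟩
  | smul c x _ hx =>
    obtain ⟨m, hm⟩ := hx
    exact ⟨c * m, by rw [map_smul, hm, smul_add, mul_smul]⟩

/-! ### Isometries fixing `delta` and the classes of the constraint -/

/-- The isometries of the Picard lattice that fix `δ`. -/
def isometries : Subgroup (Pic ≃ₗ[ℤ] Pic) where
  carrier := {g | (∀ D D', inter (g D) (g D') = inter D D') ∧ g delta = delta}
  one_mem' := ⟨fun _ _ => rfl, rfl⟩
  mul_mem' := by
    rintro v w ⟨hv, hv'⟩ ⟨hw, hw'⟩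
    exact ⟨fun D D' => by rw [LinearEquiv.mul_apply, LinearEquiv.mul_apply, hv, hw],
      by rw [LinearEquiv.mul_apply, hw', hv']⟩
  inv_mem' := by
    rintro w ⟨hw, hw'⟩
    have h : ∀ D, w (w⁻¹ D) = D := w.apply_symm_apply
    exact ⟨fun D D' => by rw [← hw, h, h], w.injective (by rw [h, hw'])⟩

theorem refl_mem_isometries {a : Pic} (h : inter a a = -2) (ha : inter a delta = 0) :
    refl a h ∈ isometries := by
  refine ⟨fun D D' => ?_, ?_⟩
  · simp only [refl_apply, map_add, map_smul, LinearMap.add_apply, LinearMap.smul_apply, h,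
      smul_eq_mul, inter_comm D a]
    ring
  · rw [refl_apply, ha, zero_smul, add_zero]

theorem wBeta_mem_isometries (i : Fin 7) : wBeta i ∈ isometries :=
  refl_mem_isometries _ (by revert i; decide)

/-- The isometries of the Picard lattice that fix `δ` and the two classes of the constraint. -/
def pointwiseFixer : Subgroup (Pic ≃ₗ[ℤ] Pic) where
  carrier := {g | g ∈ isometries ∧ g clsA = clsA ∧ g clsB = clsB}
  one_mem' := ⟨isometries.one_mem, rfl, rfl⟩
  mul_mem' := by
    rintro v w ⟨hv, hv', hv''⟩ ⟨hw, hw', hw''⟩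
    exact ⟨mul_mem hv hw, by rw [LinearEquiv.mul_apply, hw', hv'],
      by rw [LinearEquiv.mul_apply, hw'', hv'']⟩
  inv_mem' := by
    rintro w ⟨hw, hw', hw''⟩
    have h : ∀ D, w (w⁻¹ D) = D := w.apply_symm_apply
    exact ⟨inv_mem hw, w.injective (by rw [h, hw']), w.injective (by rw [h, hw''])⟩

theorem inter_beta_clsA (i : Fin 7) : inter (beta i) clsA = 0 := by revert i; decide
theorem inter_beta_clsB (i : Fin 7) : inter (beta i) clsB = 0 := by revert i; decide

theorem wBeta_mem_pointwiseFixer (i : Fin 7) : wBeta i ∈ pointwiseFixer := by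
  refine ⟨wBeta_mem_isometries i, ?_, ?_⟩
  · rw [wBeta_apply, inter_beta_clsA, zero_smul, add_zero]
  · rw [wBeta_apply, inter_beta_clsB, zero_smul, add_zero]

/-- The subgroup generated by the reflections in `β₀, …, β₆`. -/
def reflectionsB : Subgroup (Pic ≃ₗ[ℤ] Pic) := Subgroup.closure (Set.range wBeta)

theorem wBeta_mem_reflectionsB (i : Fin 7) : wBeta i ∈ reflectionsB :=
  Subgroup.subset_closure ⟨i, rfl⟩

theorem reflectionsB_le : reflectionsB ≤ pointwiseFixer := by
  rw [reflectionsB, Subgroup.closure_le]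
  rintro _ ⟨i, rfl⟩
  exact wBeta_mem_pointwiseFixer i

/-- The eight exceptional coefficients have sum -2(x + y), so by Cauchy–Schwarz their squares have
sum at least (x + y)²/2, and 2xy - (x + y)²/2 = -(x - y)²/2. -/
theorem inter_self_nonpos {D : Pic} (hD : inter delta D = 0) : inter D D ≤ 0 := by
  obtain ⟨x, y, a, b, c, d, e, f, g, h, rfl⟩ := exists_vec D
  rw [delta_eq, inter_vec] at hD
  rw [inter_vec]
  have hs : a + b + c + d + e + f + g + h = -2 * (x + y) := by linarith
  have hq : (4 * a + (x + y)) ^ 2 + (4 * b + (x + y)) ^ 2 + (4 * c + (x + y)) ^ 2 +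
      (4 * d + (x + y)) ^ 2 + (4 * e + (x + y)) ^ 2 + (4 * f + (x + y)) ^ 2 +
      (4 * g + (x + y)) ^ 2 + (4 * h + (x + y)) ^ 2 =
      16 * (a * a + b * b + c * c + d * d + e * e + f * f + g * g + h * h) - 8 * (x + y) ^ 2 := by
    linear_combination 8 * (x + y) * hs
  have hp : 0 ≤ (4 * a + (x + y)) ^ 2 + (4 * b + (x + y)) ^ 2 + (4 * c + (x + y)) ^ 2 +
      (4 * d + (x + y)) ^ 2 + (4 * e + (x + y)) ^ 2 + (4 * f + (x + y)) ^ 2 +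
      (4 * g + (x + y)) ^ 2 + (4 * h + (x + y)) ^ 2 := by positivity
  nlinarith [sq_nonneg (x - y)]

/-- A class that has the product `1` with all the `β_i`. -/
def clsRho : Pic := vec 0 1 0 1 0 1 1 2 1 2

theorem inter_beta_clsRho (i : Fin 7) : inter (beta i) clsRho = 1 := by revert i; decide

/-- Since gρ - ρ is orthogonal to `delta`, its square 2(ρ • ρ) - 2(gρ • ρ) is not positive. This is
the lower bound that makes the descent to a dominant vector stop. -/
theorem inter_clsRho_le {g : Pic ≃ₗ[ℤ] Pic} (hg : g ∈ isometries) :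
    inter clsRho clsRho ≤ inter (g clsRho) clsRho := by
  have h1 : inter delta (g clsRho - clsRho) = 0 := by
    have := hg.1 delta clsRho
    rw [hg.2] at this
    rw [map_sub, this, sub_self]
  have h2 := inter_self_nonpos h1
  simp only [map_sub, LinearMap.sub_apply, hg.1, inter_comm clsRho (g clsRho)] at h2
  linarith

/-- If gρ has a negative product with some `beta i`, the reflection adds exactly that product to gρ
• ρ, because `beta i` has product 1 with ρ. So the excess `n` drops and strong induction applies. -/
theorem exists_mem_reflectionsB_dominant (n : ℕ) : ∀ g ∈ isometries,
    inter (g clsRho) clsRho = inter clsRho clsRho + n →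
    ∃ w ∈ reflectionsB, ∀ i, 0 ≤ inter (beta i) ((w * g) clsRho) := by
  induction n using Nat.strong_induction_on with
  | _ n ih =>
    intro g hg hn
    by_cases H : ∀ i, 0 ≤ inter (beta i) (g clsRho)
    · exact ⟨1, one_mem _, by simpa using H⟩
    push Not at H
    obtain ⟨i, hi⟩ := H
    have hg' := mul_mem (wBeta_mem_isometries i) hg
    have hle := inter_clsRho_le hg'
    have hlt : inter ((wBeta i * g) clsRho) clsRho =
        inter (g clsRho) clsRho + inter (beta i) (g clsRho) := by
      rw [LinearEquiv.mul_apply, wBeta_apply, map_add, map_smul, LinearMap.add_apply,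
        LinearMap.smul_apply, inter_beta_clsRho, smul_eq_mul, mul_one]
    obtain ⟨m, hm⟩ := Int.eq_ofNat_of_zero_le (sub_nonneg.2 hle)
    obtain ⟨w, hw, h⟩ := ih m (by omega) _ hg' (by omega)
    exact ⟨w * wBeta i, mul_mem hw (wBeta_mem_reflectionsB i), by simpa only [mul_assoc] using h⟩

/-! ### Real roots of the affine root system -/

/-- Half the quadratic form of type `D₆⁽¹⁾`. -/
def quadD6 (n : Fin 7 → ℤ) : ℤ :=
  n 0 ^ 2 + n 1 ^ 2 + n 2 ^ 2 + n 3 ^ 2 + n 4 ^ 2 + n 5 ^ 2 + n 6 ^ 2 - n 0 * n 2 - n 1 * n 2 -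
    n 2 * n 3 - n 3 * n 4 - n 4 * n 5 - n 4 * n 6

theorem four_mul_quadD6 (n : Fin 7 → ℤ) : 4 * quadD6 n =
    (2 * n 0 - n 2) ^ 2 + (2 * n 1 - n 2) ^ 2 + 2 * (n 2 - n 3) ^ 2 + 2 * (n 3 - n 4) ^ 2 +
      (2 * n 5 - n 4) ^ 2 + (2 * n 6 - n 4) ^ 2 := by
  rw [quadD6]; ring

theorem quadD6_nonneg (n : Fin 7 → ℤ) : 0 ≤ quadD6 n := by
  have h := four_mul_quadD6 n
  have : 0 ≤ (2 * n 0 - n 2) ^ 2 + (2 * n 1 - n 2) ^ 2 + 2 * (n 2 - n 3) ^ 2 +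
    2 * (n 3 - n 4) ^ 2 + (2 * n 5 - n 4) ^ 2 + (2 * n 6 - n 4) ^ 2 := by positivity
  omega

/-- All squares in `four_mul_quadD6` vanish, so the null vectors are the multiples of `delta`; a
nonzero one has full support. -/
theorem eq_of_quadD6_eq_zero {n : Fin 7 → ℤ} (hn : quadD6 n = 0) :
    n 2 = 2 * n 0 ∧ n 1 = n 0 ∧ n 3 = 2 * n 0 ∧ n 4 = 2 * n 0 ∧ n 5 = n 0 ∧ n 6 = n 0 := by
  have h := four_mul_quadD6 n
  rw [hn] at h
  have h0 := sq_nonneg (2 * n 0 - n 2)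
  have h1 := sq_nonneg (2 * n 1 - n 2)
  have h2 := sq_nonneg (n 2 - n 3)
  have h3 := sq_nonneg (n 3 - n 4)
  have h5 := sq_nonneg (2 * n 5 - n 4)
  have h6 := sq_nonneg (2 * n 6 - n 4)
  have e0 := pow_eq_zero_iff (two_ne_zero) |>.1 (show (2 * n 0 - n 2) ^ 2 = 0 by linarith)
  have e1 := pow_eq_zero_iff (two_ne_zero) |>.1 (show (2 * n 1 - n 2) ^ 2 = 0 by linarith)
  have e2 := pow_eq_zero_iff (two_ne_zero) |>.1 (show (n 2 - n 3) ^ 2 = 0 by linarith)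
  have e3 := pow_eq_zero_iff (two_ne_zero) |>.1 (show (n 3 - n 4) ^ 2 = 0 by linarith)
  have e5 := pow_eq_zero_iff (two_ne_zero) |>.1 (show (2 * n 5 - n 4) ^ 2 = 0 by linarith)
  have e6 := pow_eq_zero_iff (two_ne_zero) |>.1 (show (2 * n 6 - n 4) ^ 2 = 0 by linarith)
  omega

/-- A null positive part `p` is zero or has full support. Full support would make `m` vanish and `n
= p` null, against `hn`. -/
theorem posPart_nonneg_of_quadD6 {n p m : Fin 7 → ℤ} (hn : quadD6 n = 1)
    (hnpm : ∀ i, n i = p i - m i) (hm : ∀ i, 0 ≤ m i)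
    (hpm : ∀ i, p i = 0 ∨ m i = 0) (h0 : quadD6 p = 0) : ∀ i, n i ≤ 0 := by
  obtain ⟨e2, e1, e3, e4, e5, e6⟩ := eq_of_quadD6_eq_zero h0
  by_cases hz : p 0 = 0
  · intro i
    have hpi : p i = 0 := by fin_cases i <;> simp_all
    have := hnpm i
    have := hm i
    omega
  · exfalso
    have hm0 : ∀ i, m i = 0 := by
      intro i
      refine (hpm i).resolve_left ?_
      fin_cases i <;> simp_all
    have : n = p := by ext i; rw [hnpm, hm0, sub_zero]
    rw [this, h0] at hn
    exact zero_ne_one hn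

/-- A real root of type `D₆⁽¹⁾` is positive or negative. -/
theorem nonneg_or_nonpos_of_quadD6 {n : Fin 7 → ℤ} (hn : quadD6 n = 1) :
    (∀ i, 0 ≤ n i) ∨ ∀ i, n i ≤ 0 := by
  have hp : ∀ i, 0 ≤ (n i)⁺ := fun i => posPart_nonneg _
  have hm : ∀ i, 0 ≤ (n i)⁻ := fun i => negPart_nonneg _
  have hnpm : ∀ i, n i = (n i)⁺ - (n i)⁻ := fun i => (posPart_sub_negPart _).symm
  have hpm : ∀ i, (n i)⁺ = 0 ∨ (n i)⁻ = 0 := fun i => by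
    rcases le_total 0 (n i) with h | h
    · exact .inr (negPart_eq_zero.2 h)
    · exact .inl (posPart_eq_zero.2 h)
  generalize hP : (fun i => (n i)⁺) = p at *
  generalize hM : (fun i => (n i)⁻) = m at *
  have hP' : ∀ i, (n i)⁺ = p i := congrFun hP
  have hM' : ∀ i, (n i)⁻ = m i := congrFun hM
  simp only [hP', hM'] at hp hm hnpm hpm
  have hpm' : ∀ i, p i * m i = 0 := fun i => mul_eq_zero.2 (hpm i)
  have hmul : ∀ i j, 0 ≤ p i * m j := fun i j => mul_nonneg (hp i) (hm j)
  -- Supports are disjoint and off-diagonal coefficients are nonpositive, so the mixed terms of the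
  -- form at `p - m` are nonnegative.
  have key : quadD6 p + quadD6 m ≤ 1 := by
    rw [← hn]
    simp only [quadD6, hnpm]
    linarith [hpm' 0, hpm' 1, hpm' 2, hpm' 3, hpm' 4, hpm' 5, hpm' 6, hmul 0 2, hmul 2 0, hmul 1 2,
      hmul 2 1, hmul 2 3, hmul 3 2, hmul 3 4, hmul 4 3, hmul 4 5, hmul 5 4, hmul 4 6, hmul 6 4]
  have h1 := quadD6_nonneg p
  have h2 := quadD6_nonneg m
  rcases (by omega : quadD6 p = 0 ∨ quadD6 m = 0) with h | h
  · exact .inr (posPart_nonneg_of_quadD6 hn hnpm hm hpm h)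
  · left
    have hn' : quadD6 (fun i => -n i) = 1 := by rw [← hn]; simp only [quadD6]; ring
    have := posPart_nonneg_of_quadD6 hn' (fun i => by rw [hnpm]; ring) hp
      (fun i => (hpm i).symm) h
    exact fun i => by have := this i; omega

/-- The classes orthogonal to `δ` and to the classes of the constraint are the integral
combinations of the `β_i`. -/
theorem exists_eq_sum_beta {D : Pic} (hd : inter delta D = 0) (ha : inter clsA D = 0)
    (hb : inter clsB D = 0) : ∃ n : Fin 7 → ℤ, D = ∑ i, n i • beta i := by
  obtain ⟨x, y, a, b, c, d, e, f, g, h, rfl⟩ := exists_vec D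
  rw [delta_eq, inter_vec] at hd
  rw [clsA, inter_vec] at ha
  rw [clsB, inter_vec] at hb
  -- The second, fourth, sixth and eighth exceptional classes and `Hx` each occur in one simple root
  -- only; this fixes five coefficients, and those of the first and third exceptional classes give
  -- the other two.
  refine ⟨![-b, -f, -a - b, x, -c - d, -d, -h], ?_⟩
  simp only [Fin.sum_univ_seven, beta_zero, beta_one, beta_two, beta_three, beta_four, beta_five,
    beta_six, vec_smul, vec_add, vec_inj]
  simp
  omega

theorem inter_sum_beta_self (n : Fin 7 → ℤ) :
    inter (∑ i, n i • beta i) (∑ i, n i • beta i) = -2 * quadD6 n := by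
  simp only [Fin.sum_univ_seven, beta_zero, beta_one, beta_two, beta_three, beta_four, beta_five,
    beta_six, vec_smul, vec_add, inter_vec, quadD6]
  ring

theorem inter_sum_beta_clsRho (n : Fin 7 → ℤ) :
    inter (∑ i, n i • beta i) clsRho = ∑ i, n i := by
  simp only [map_sum, map_smul, LinearMap.sum_apply, LinearMap.smul_apply, inter_beta_clsRho,
    smul_eq_mul, mul_one]

/-- A class of square `-2` in the span of the `β_i` is not orthogonal to `ρ`, and is one of the
`β_i` when its product with `ρ` is `1`. -/
theorem root_dichotomy {D : Pic} (hd : inter delta D = 0) (ha : inter clsA D = 0)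
    (hb : inter clsB D = 0) (hD : inter D D = -2) :
    inter D clsRho ≠ 0 ∧ (inter D clsRho = 1 → ∃ i, D = beta i) := by
  obtain ⟨n, rfl⟩ := exists_eq_sum_beta hd ha hb
  have hn : quadD6 n = 1 := by rw [inter_sum_beta_self] at hD; omega
  rw [inter_sum_beta_clsRho]
  have hz : ¬ ∀ i, n i = 0 := by
    intro h
    simp [quadD6, h] at hn
  refine ⟨fun h => hz ?_, fun h => ?_⟩
  · rw [Fin.sum_univ_seven] at h
    rcases nonneg_or_nonpos_of_quadD6 hn with H | H
    · have := H 0; have := H 1; have := H 2; have := H 3; have := H 4; have := H 5; have := H 6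
      intro i; fin_cases i <;> simp <;> omega
    · have := H 0; have := H 1; have := H 2; have := H 3; have := H 4; have := H 5; have := H 6
      intro i; fin_cases i <;> simp <;> omega
  · have H : ∀ i, 0 ≤ n i := by
      refine (nonneg_or_nonpos_of_quadD6 hn).resolve_right fun H => ?_
      have := Finset.sum_nonpos fun i (_ : i ∈ Finset.univ) => H i
      omega
    push Not at hz
    obtain ⟨i, hi⟩ := hz
    refine ⟨i, ?_⟩
    have hi' : 1 ≤ n i := by have := H i; omega
    -- Nonnegative integers with sum 1 and one entry at least 1: all other entries vanish.
    have hsplit := Finset.add_sum_erase Finset.univ n (Finset.mem_univ i)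
    have hnn : 0 ≤ ∑ j ∈ Finset.univ.erase i, n j := Finset.sum_nonneg fun j _ => H j
    have hzero : ∑ j ∈ Finset.univ.erase i, n j = 0 := by omega
    rw [Finset.sum_eq_zero_iff_of_nonneg fun j _ => H j] at hzero
    rw [Finset.sum_eq_single i (fun j _ hj => by rw [hzero j (by simp [hj]), zero_smul]) (by simp),
      show n i = 1 by omega, one_smul]

/-! ### Rigidity of isometries and diagram automorphisms -/

/-- A, B and the `beta i` have rank 9 and span the complement of `delta` rationally, so only the
radical direction is orthogonal to all of them; `delta` is primitive. -/
theorem exists_eq_smul_delta {D : Pic} (ha : inter clsA D = 0) (hb : inter clsB D = 0)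
    (h : ∀ i, inter (beta i) D = 0) : ∃ n : ℤ, D = n • delta := by
  obtain ⟨x, y, a, b, c, d, e, f, g, k, rfl⟩ := exists_vec D
  have h0 := h 0
  have h1 := h 1
  have h2 := h 2
  have h3 := h 3
  have h4 := h 4
  have h5 := h 5
  have h6 := h 6
  rw [clsA, inter_vec] at ha
  rw [clsB, inter_vec] at hb
  rw [beta_zero, inter_vec] at h0
  rw [beta_one, inter_vec] at h1
  rw [beta_two, inter_vec] at h2
  rw [beta_three, inter_vec] at h3
  rw [beta_four, inter_vec] at h4
  rw [beta_five, inter_vec] at h5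
  rw [beta_six, inter_vec] at h6
  refine ⟨-a, ?_⟩
  rw [delta_eq, vec_smul, vec_inj]
  omega

/-- An isometry that fixes `δ`, the classes of the constraint and the `β_i` is the identity. -/
theorem eq_one_of_fixes {g : Pic ≃ₗ[ℤ] Pic} (hg : g ∈ pointwiseFixer)
    (h : ∀ i, g (beta i) = beta i) : g = 1 := by
  obtain ⟨⟨hi, hd⟩, ha, hb⟩ := hg
  -- Here `g D` is `D + n • delta`, and preservation of the square of `D` gives n (δ • D) = 0.
  have key : ∀ D, inter delta D ≠ 0 → g D = D := by
    intro D hD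
    have orth : ∀ F, g F = F → inter F (g D - D) = 0 := fun F hF => by
      have := hi F D
      rw [hF] at this
      rw [map_sub, this, sub_self]
    obtain ⟨n, hn⟩ := exists_eq_smul_delta (orth _ ha) (orth _ hb) fun i => orth _ (h i)
    have hgD : g D = D + n • delta := by rw [← hn]; abel
    have hdd : inter delta delta = 0 := by decide
    have hDD := hi D D
    rw [hgD] at hDD
    simp only [map_add, map_smul, LinearMap.add_apply, LinearMap.smul_apply, smul_eq_mul, hdd,
      inter_comm D delta] at hDD
    have : n * inter delta D = 0 := by linarith
    rw [hgD, (mul_eq_zero.1 this).resolve_right hD, zero_smul, add_zero]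
  ext1 D
  have hH : inter delta Hx = 2 := by decide
  by_cases hD : inter delta D = 0
  -- Shifting by `Hx` leaves the complement of `delta`, where `key` applies.
  · have h1 := key (D + Hx) (by rw [map_add, hD, hH]; decide)
    rw [map_add, key Hx (by rw [hH]; decide)] at h1
    exact add_right_cancel h1
  · exact key D hD

/-- Node 3 is the only midpoint of a path with four edges in the diagram. This pins down the images
of 3, 2 and 4 without searching all maps. -/
theorem path_of_length_four (x3 x2 x4 : Fin 7) : ¬ (cartanD6 x3 x2 = -1 ∧ cartanD6 x3 x4 = -1 ∧
    cartanD6 x2 x4 = 0 ∧ (∃ x0 : Fin 7, cartanD6 x2 x0 = -1 ∧ cartanD6 x3 x0 = 0) ∧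
    ∃ x5 : Fin 7, cartanD6 x4 x5 = -1 ∧ cartanD6 x3 x5 = 0) ∨
    x3 = 3 ∧ (x2 = 2 ∧ x4 = 4 ∨ x2 = 4 ∧ x4 = 2) := by
  fin_cases x3 <;> fin_cases x2 <;> fin_cases x4 <;> decide

theorem leaves_two : ∀ x : Fin 7, cartanD6 2 x = -1 ∧ cartanD6 3 x = 0 → x = 0 ∨ x = 1 := by
  decide

theorem leaves_four : ∀ x : Fin 7, cartanD6 4 x = -1 ∧ cartanD6 3 x = 0 → x = 5 ∨ x = 6 := by
  decide

theorem diagram_automorphism_mem (f : Fin 7 → Fin 7)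
    (hf : ∀ i j, cartanD6 (f i) (f j) = cartanD6 i j) :
    f ∈ ({![0, 1, 2, 3, 4, 5, 6], ![1, 0, 2, 3, 4, 5, 6],
      ![0, 1, 2, 3, 4, 6, 5], ![1, 0, 2, 3, 4, 6, 5], ![5, 6, 4, 3, 2, 0, 1],
      ![6, 5, 4, 3, 2, 0, 1], ![5, 6, 4, 3, 2, 1, 0], ![6, 5, 4, 3, 2, 1, 0]} :
      Finset (Fin 7 → Fin 7)) := by
  -- Injectivity of `f` is not assumed; the diagonal entries 2 separate the images of non-adjacent
  -- nodes, in particular of the two leaves at each end.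
  have hne : ∀ i j, cartanD6 i j = 0 → f i ≠ f j := by
    intro i j hij h
    have h1 := hf i j
    have h2 : ∀ k, cartanD6 k k ≠ 0 := by decide
    rw [hij, h] at h1
    exact h2 _ h1
  have h01 := hne 0 1 (by decide)
  have h56 := hne 5 6 (by decide)
  have heta : f = ![f 0, f 1, f 2, f 3, f 4, f 5, f 6] := by
    ext i
    fin_cases i <;> rfl
  obtain ⟨h3, ⟨h2, h4⟩ | ⟨h2, h4⟩⟩ := (path_of_length_four (f 3) (f 2) (f 4)).resolve_left
    (not_not.2 ⟨hf _ _, hf _ _, hf _ _, ⟨f 0, hf _ _, hf _ _⟩, ⟨f 5, hf _ _, hf _ _⟩⟩)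
  · have h0 := leaves_two (f 0) ⟨by rw [← h2, hf]; rfl, by rw [← h3, hf]; rfl⟩
    have h1 := leaves_two (f 1) ⟨by rw [← h2, hf]; rfl, by rw [← h3, hf]; rfl⟩
    have h5 := leaves_four (f 5) ⟨by rw [← h4, hf]; rfl, by rw [← h3, hf]; rfl⟩
    have h6 := leaves_four (f 6) ⟨by rw [← h4, hf]; rfl, by rw [← h3, hf]; rfl⟩
    rcases h0 with h0 | h0 <;> rcases h1 with h1 | h1 <;> rcases h5 with h5 | h5 <;>
      rcases h6 with h6 | h6 <;> rw [h0, h1] at h01 <;> rw [h5, h6] at h56 <;>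
      first | exact absurd rfl h01 | exact absurd rfl h56 |
        (rw [heta, h0, h1, h2, h3, h4, h5, h6]; decide)
  · have h0 := leaves_four (f 0) ⟨by rw [← h2, hf]; rfl, by rw [← h3, hf]; rfl⟩
    have h1 := leaves_four (f 1) ⟨by rw [← h2, hf]; rfl, by rw [← h3, hf]; rfl⟩
    have h5 := leaves_two (f 5) ⟨by rw [← h4, hf]; rfl, by rw [← h3, hf]; rfl⟩
    have h6 := leaves_two (f 6) ⟨by rw [← h4, hf]; rfl, by rw [← h3, hf]; rfl⟩
    rcases h0 with h0 | h0 <;> rcases h1 with h1 | h1 <;> rcases h5 with h5 | h5 <;>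
      rcases h6 with h6 | h6 <;> rw [h0, h1] at h01 <;> rw [h5, h6] at h56 <;>
      first | exact absurd rfl h01 | exact absurd rfl h56 |
        (rw [heta, h0, h1, h2, h3, h4, h5, h6]; decide)

/-- This divisibility by 2 and the next one by 4 glue the span of A and B to the root lattice: an
automorphism cannot move one of the two lattices arbitrarily while fixing the other. -/
theorem two_smul_E_sub : (2 : ℤ) • (E 0 - E 5) = clsA + beta 0 + beta 1 := by decide

theorem four_smul_E_sub : (4 : ℤ) • (E 0 - E 2) = clsA - clsB + beta 0 - beta 1 -
    (2 : ℤ) • beta 2 + (2 : ℤ) • beta 4 - beta 5 + beta 6 := by decide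

/-- A linear automorphism that fixes the classes of the constraint and permutes the `β_i` by a
diagram automorphism fixes the `β_i`. -/
theorem permutation_eq_id {g : Pic ≃ₗ[ℤ] Pic} (ha : g clsA = clsA) (hb : g clsB = clsB)
    {f : Fin 7 → Fin 7} (hf : ∀ i j, cartanD6 (f i) (f j) = cartanD6 i j)
    (hg : ∀ i, g (beta i) = beta (f i)) : ∀ i, f i = i := by
  have h2 := congrArg g two_smul_E_sub
  have h4 := congrArg g four_smul_E_sub
  simp only [map_smul, map_add, map_sub, ha, hb, hg] at h2 h4
  obtain ⟨x, y, z1, z2, z3, z4, z5, z6, z7, z8, h⟩ := exists_vec (g (E 0) - g (E 5))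
  obtain ⟨x', y', z1', z2', z3', z4', z5', z6', z7', z8', h'⟩ := exists_vec (g (E 0) - g (E 2))
  rw [h] at h2
  rw [h'] at h4
  have := diagram_automorphism_mem f hf
  simp only [Finset.mem_insert, Finset.mem_singleton] at this
  -- Exchanging the two ends violates divisibility by 2; swapping leaves within the ends violates
  -- divisibility by 4.
  rcases this with rfl | rfl | rfl | rfl | rfl | rfl | rfl | rfl
  · decide
  all_goals
    exfalso
    simp [beta_zero, beta_one, beta_two, beta_four, beta_five, beta_six, clsA, clsB,
      vec_smul, vec_add, vec_sub, vec_inj, -zsmul_eq_mul] at h2 h4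
    omega

theorem inter_delta_eq (D : Pic) : inter delta D = inter (beta 0) D + inter (beta 1) D +
    2 * inter (beta 2) D + 2 * inter (beta 3) D + 2 * inter (beta 4) D + inter (beta 5) D +
    inter (beta 6) D := by
  rw [delta_eq_beta]
  simp only [map_add, map_smul, LinearMap.add_apply, LinearMap.smul_apply, smul_eq_mul]

/-! ### The pointwise fixer is the reflection group -/

/-- The isometries that fix `δ` and the classes of the constraint are generated by the
reflections in the `β_i`. -/
theorem pointwiseFixer_eq : pointwiseFixer = reflectionsB := by
  refine le_antisymm (fun g hg => ?_) reflectionsB_le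
  obtain ⟨n, hn⟩ := Int.eq_ofNat_of_zero_le (sub_nonneg.2 (inter_clsRho_le hg.1))
  obtain ⟨w, hw, hpos⟩ := exists_mem_reflectionsB_dominant n g hg.1 (by omega)
  set k := w * g with hk
  have hkm : k ∈ pointwiseFixer := mul_mem (reflectionsB_le hw) hg
  -- After this reduction kρ is dominant, and the claim is that such a `k` is trivial.
  suffices k⁻¹ = 1 by
    have : g = w⁻¹ := by rw [← mul_one w⁻¹, ← inv_eq_one.1 this, hk]; group
    rw [this]
    exact inv_mem hw
  have hkm' := inv_mem hkm
  obtain ⟨⟨hi, hd⟩, ha, hb⟩ := hkm'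
  have hkk : ∀ D, k⁻¹ (k D) = D := k.symm_apply_apply
  have hroot : ∀ i, inter (k⁻¹ (beta i)) clsRho = inter (beta i) (k clsRho) := fun i => by
    rw [← hi (beta i), hkk]
  have hdich : ∀ i, _ := fun i => root_dichotomy (D := k⁻¹ (beta i))
    (by rw [← hd, hi]; revert i; decide) (by rw [← ha, hi]; revert i; decide)
    (by rw [← hb, hi]; revert i; decide) (by rw [hi]; exact beta_sq i)
  have hge : ∀ i, 1 ≤ inter (beta i) (k clsRho) := fun i => by
    have h1 := hpos i
    have h2 := (hdich i).1
    rw [hroot] at h2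
    omega
  -- The products are at least 1, and weighted by the coefficients of `delta`, which have sum 10,
  -- they add up to δ • ρ = 10; so each equals 1.
  have hone : ∀ i, inter (beta i) (k clsRho) = 1 := by
    have h1 : inter delta (k clsRho) = 10 := by
      rw [← hkm.1.2, hkm.1.1]; decide
    rw [inter_delta_eq] at h1
    have := hge 0
    have := hge 1
    have := hge 2
    have := hge 3
    have := hge 4
    have := hge 5
    have := hge 6
    intro i
    fin_cases i <;> simp <;> omega
  choose f hf using fun i => (hdich i).2 ((hroot i).trans (hone i))
  refine eq_one_of_fixes (inv_mem hkm) fun i => ?_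
  rw [hf, permutation_eq_id ha hb (fun i j => ?_) hf]
  have := hi (beta i) (beta j)
  rw [hf, hf, inter_beta, inter_beta] at this
  exact neg_injective this

/-! ### Permutations and simple reflections inside the Weyl group of type E₈⁽¹⁾ -/

theorem weylE8_le_isometries : weylE8 ≤ isometries := by
  rw [weylE8, Subgroup.closure_le]
  rintro _ ⟨i, rfl⟩
  exact refl_mem_isometries _ (by revert i; decide)

theorem permE_mul (π ρ : Equiv.Perm (Fin 8)) : permE (π * ρ) = permE π * permE ρ := by
  ext D i
  rcases i with i | i <;> rfl

/-- The action of the permutations of the exceptional classes. -/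
def permEHom : Equiv.Perm (Fin 8) →* (Pic ≃ₗ[ℤ] Pic) where
  toFun := permE
  map_one' := by
    ext D i
    rcases i with i | i <;> rfl
  map_mul' := permE_mul

theorem refl_alpha_mem (i : Fin 9) : refl (alpha i) (alpha_sq i) ∈ weylE8 :=
  Subgroup.subset_closure ⟨i, rfl⟩

theorem permE_E (π : Equiv.Perm (Fin 8)) (k : Fin 8) : permE π (E k) = E (π k) := by
  ext i
  rcases i with i | i
  · simp [permE, E, LinearEquiv.funCongrLeft, LinearMap.funLeft]
  · simp [permE, E, LinearEquiv.funCongrLeft, LinearMap.funLeft, Pi.single_apply,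
      Equiv.symm_apply_eq]

theorem permE_Hx (π : Equiv.Perm (Fin 8)) : permE π Hx = Hx := by
  ext i
  rcases i with i | i <;> simp [permE, Hx, LinearEquiv.funCongrLeft, LinearMap.funLeft]

theorem permE_Hy (π : Equiv.Perm (Fin 8)) : permE π Hy = Hy := by
  ext i
  rcases i with i | i <;> simp [permE, Hy, LinearEquiv.funCongrLeft, LinearMap.funLeft]

theorem linearEquiv_ext_basis {v w : Pic ≃ₗ[ℤ] Pic} (hx : v Hx = w Hx) (hy : v Hy = w Hy)
    (hE : ∀ k, v (E k) = w (E k)) : v = w := by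
  refine LinearEquiv.toLinearMap_injective ((Pi.basisFun ℤ (Fin 2 ⊕ Fin 8)).ext fun i => ?_)
  rw [Pi.basisFun_apply]
  rcases i with i | k
  · fin_cases i
    · exact hx
    · exact hy
  · exact hE k

/-- Every simple root other than `alpha 1` and `alpha 2` is a difference of consecutive exceptional
classes, and its reflection swaps them. -/
theorem permE_swap_mem (i : Fin 7) : permE (Equiv.swap i.castSucc i.succ) ∈ weylE8 := by
  have h := refl_alpha_mem (![0, 3, 4, 5, 6, 7, 8] i)
  convert h using 1
  clear h
  refine linearEquiv_ext_basis ?_ ?_ fun k => ?_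
  · rw [permE_Hx, refl_apply]; revert i; decide
  · rw [permE_Hy, refl_apply]; revert i; decide
  · rw [permE_E, refl_apply]; revert i k; decide

theorem permE_mem_weylE8 (π : Equiv.Perm (Fin 8)) : permE π ∈ weylE8 := by
  have h : (⊤ : Submonoid (Equiv.Perm (Fin 8))) ≤ (weylE8.comap permEHom).toSubmonoid := by
    rw [← Equiv.Perm.mclosure_swap_castSucc_succ 7, Submonoid.closure_le]
    rintro _ ⟨i, rfl⟩
    exact permE_swap_mem i
  exact h (Submonoid.mem_top π)

theorem refl_conj {g : Pic ≃ₗ[ℤ] Pic} (hg : g ∈ isometries) {a b : Pic} (ha : inter a a = -2)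
    (hb : inter b b = -2) (hab : g a = b) : refl b hb = g * refl a ha * g⁻¹ := by
  rw [eq_mul_inv_iff_mul_eq]
  ext1 D
  rw [LinearEquiv.mul_apply, LinearEquiv.mul_apply, refl_apply, refl_apply, map_add, map_smul, hab,
    ← hg.1 a D, hab]

theorem refl_mem_of_permE {π : Equiv.Perm (Fin 8)} {i : Fin 9} {b : Pic} (hb : inter b b = -2)
    (h : permE π (alpha i) = b) : refl b hb ∈ weylE8 := by
  rw [refl_conj (weylE8_le_isometries (permE_mem_weylE8 π)) (alpha_sq i) hb h]
  exact mul_mem (mul_mem (permE_mem_weylE8 π) (refl_alpha_mem i)) (inv_mem (permE_mem_weylE8 π))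

theorem wBeta_mem_weylE8 (i : Fin 7) : wBeta i ∈ weylE8 := by
  -- Each `beta i` is a permutation of the exceptional classes away from a simple root, so its
  -- reflection is a conjugate of a simple one.
  have h : ∀ i : Fin 7, ∃ (j : Fin 9) (π : Equiv.Perm (Fin 8)), permE π (alpha j) = beta i := by
    intro i
    fin_cases i
    · exact ⟨0, 1, by decide⟩
    · exact ⟨6, 1, by decide⟩
    · exact ⟨2, Equiv.swap 1 4, by decide⟩
    · exact ⟨1, 1, by decide⟩
    · exact ⟨2, Equiv.swap 0 2 * Equiv.swap 1 6, by decide⟩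
    · exact ⟨4, 1, by decide⟩
    · exact ⟨8, 1, by decide⟩
  obtain ⟨j, π, hπ⟩ := h i
  exact refl_mem_of_permE _ hπ

theorem sigma1_mem_weylE8 : sigma1 ∈ weylE8 := permE_mem_weylE8 _

theorem sigma2_mem_weylE8 : sigma2 ∈ weylE8 := permE_mem_weylE8 _

/-! ### Which elements preserve the constraint -/

/-- Two orthogonal classes of square `-4` in the span of the classes of the constraint are these
classes up to order and sign. -/
theorem signed_permutation {D F : Pic} (hDD : inter D D = -4) (hFF : inter F F = -4)
    (hDF : inter D F = 0) (hD : ∃ m n : ℤ, D = m • clsA + n • clsB)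
    (hF : ∃ m n : ℤ, F = m • clsA + n • clsB) :
    (D = clsA ∨ D = -clsA) ∧ (F = clsB ∨ F = -clsB) ∨
      (D = clsB ∨ D = -clsB) ∧ (F = clsA ∨ F = -clsA) := by
  obtain ⟨m, n, rfl⟩ := hD
  obtain ⟨k, l, rfl⟩ := hF
  simp only [clsA, clsB, vec_smul, vec_add, inter_vec] at hDD hFF hDF
  -- Dividing by -4 turns the data into an orthonormal pair in ℤ².
  have h1 : m ^ 2 + n ^ 2 = 1 := by linarith
  have h2 : k ^ 2 + l ^ 2 = 1 := by linarith
  have h3 : m * k + n * l = 0 := by linarith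
  have hm : -1 ≤ m ∧ m ≤ 1 := ⟨by nlinarith, by nlinarith⟩
  have hn : -1 ≤ n ∧ n ≤ 1 := ⟨by nlinarith, by nlinarith⟩
  have hk : -1 ≤ k ∧ k ≤ 1 := ⟨by nlinarith, by nlinarith⟩
  have hl : -1 ≤ l ∧ l ≤ 1 := ⟨by nlinarith, by nlinarith⟩
  obtain ⟨hm1, hm2⟩ := hm
  obtain ⟨hn1, hn2⟩ := hn
  obtain ⟨hk1, hk2⟩ := hk
  obtain ⟨hl1, hl2⟩ := hl
  interval_cases m <;> interval_cases n <;> first | omega | skip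
  all_goals interval_cases k <;> interval_cases l <;> first | omega | simp

namespace Parameters

variable {T : Type*} [AddCommGroup T]

theorem constraint_iff (p : Parameters T) :
    p.Constraint ↔ p.pullback clsA = 0 ∧ p.pullback clsB = 0 := by
  have ha : clsA = E 0 + E 1 - E 4 - E 5 := by decide
  have hb : clsB = E 2 + E 3 - E 6 - E 7 := by decide
  simp only [ha, hb, map_add, map_sub, pullback_E, Constraint]

theorem constraint_evolve_iff (p : Parameters T) (w : Pic ≃ₗ[ℤ] Pic) :
    (p.evolve w).Constraint ↔ p.pullback (w⁻¹ clsA) = 0 ∧ p.pullback (w⁻¹ clsB) = 0 := by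
  rw [constraint_iff, pullback_evolve, pullback_evolve]

end Parameters

/-- The inverse of `w` maps the two classes of the constraint to themselves up to order and
sign. -/
def PreservesSpan (w : Pic ≃ₗ[ℤ] Pic) : Prop :=
  (w⁻¹ clsA = clsA ∨ w⁻¹ clsA = -clsA) ∧ (w⁻¹ clsB = clsB ∨ w⁻¹ clsB = -clsB) ∨
    (w⁻¹ clsA = clsB ∨ w⁻¹ clsA = -clsB) ∧ (w⁻¹ clsB = clsA ∨ w⁻¹ clsB = -clsA)

theorem PreservesSpan.mem_preservingSubgroup {w : Pic ≃ₗ[ℤ] Pic} (h : PreservesSpan w)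
    (hw : w ∈ weylE8) (τ : ℂ) : w ∈ preservingSubgroup τ := by
  refine ⟨hw, fun p => ?_⟩
  rw [Parameters.constraint_evolve_iff, Parameters.constraint_iff]
  rcases h with ⟨ha | ha, hb | hb⟩ | ⟨ha | ha, hb | hb⟩ <;>
    simp only [ha, hb, map_neg, neg_eq_zero, and_comm]

/-- If some generic parameters satisfy the constraint before and after the application of an
isometry, then the isometry preserves the span of the classes of the constraint. -/
theorem preservesSpan_of_isGeneric {T : Type*} [AddCommGroup T] {p : Parameters T}
    (hp : p.Constraint) (hg : p.IsGeneric) {w : Pic ≃ₗ[ℤ] Pic} (hw : w ∈ isometries)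
    (h : (p.evolve w).Constraint) : PreservesSpan w := by
  rw [Parameters.constraint_iff] at hp
  rw [Parameters.constraint_evolve_iff] at h
  obtain ⟨hi, hd⟩ := inv_mem hw
  have hspan : ∀ D, inter delta D = 0 → p.pullback D = 0 → ∃ m n : ℤ, D = m • clsA + n • clsB := by
    intro D hD hpD
    -- Four times the projection of `D` off A and B; the factor 4 clears the denominators coming
    -- from squares -4. Its pull-back vanishes, so genericity kills it.
    obtain ⟨c, hc⟩ := exists_eq_sum_beta
      (D := (4 : ℤ) • D + inter clsA D • clsA + inter clsB D • clsB)
      (by simp only [map_add, map_smul, hD, smul_eq_mul, show inter delta clsA = 0 by decide,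
            show inter delta clsB = 0 by decide]; ring)
      (by simp only [map_add, map_smul, smul_eq_mul, show inter clsA clsA = -4 by decide,
            show inter clsA clsB = 0 by decide]; ring)
      (by simp only [map_add, map_smul, smul_eq_mul, show inter clsB clsB = -4 by decide,
            show inter clsB clsA = 0 by decide]; ring)
    have hz := congrArg p.pullback hc
    simp only [map_add, map_smul, map_sum, hpD, hp.1, hp.2, smul_zero, add_zero] at hz
    have hc0 := Fintype.linearIndependent_iff.1 hg c hz.symm
    simp only [hc0, zero_smul, Finset.sum_const_zero] at hc
    generalize inter clsA D = s at hc
    generalize inter clsB D = t at hc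
    obtain ⟨x, y, z1, z2, z3, z4, z5, z6, z7, z8, rfl⟩ := exists_vec D
    have h0 : (0 : Pic) = vec 0 0 0 0 0 0 0 0 0 0 := by decide
    rw [clsA, clsB, h0] at hc
    simp only [vec_smul, vec_add, vec_inj] at hc
    -- Now 4D is a combination of A and B; A and B have disjoint supports with coefficients ±1, so
    -- the multipliers are the first and third exceptional coordinates.
    refine ⟨z1, z3, ?_⟩
    simp only [clsA, clsB, vec_smul, vec_add, vec_inj]
    omega
  have hsp : ∀ D, inter delta D = 0 → p.pullback (w⁻¹ D) = 0 →
      ∃ m n : ℤ, w⁻¹ D = m • clsA + n • clsB := fun D hD => hspan _ (by rw [← hd, hi, hD])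
  exact signed_permutation (by rw [hi]; decide) (by rw [hi]; decide) (by rw [hi]; decide)
    (hsp _ (by decide) h.1) (hsp _ (by decide) h.2)

theorem sigma1_inv_clsA : sigma1⁻¹ clsA = -clsB := by decide
theorem sigma1_inv_clsB : sigma1⁻¹ clsB = clsA := by decide
theorem sigma2_inv_clsA : sigma2⁻¹ clsA = -clsA := by decide
theorem sigma2_inv_clsB : sigma2⁻¹ clsB = clsB := by decide

/-- The isometries that preserve the span of the classes of the constraint are generated by the
reflections in the `β_i` and by `σ₁, σ₂`. -/
theorem PreservesSpan.mem_closure {w : Pic ≃ₗ[ℤ] Pic} (h : PreservesSpan w)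
    (hw : w ∈ isometries) : w ∈ Subgroup.closure (Set.range wBeta ∪ {sigma1, sigma2}) := by
  set G := Subgroup.closure (Set.range wBeta ∪ {sigma1, sigma2}) with hG
  have h1 : sigma1 ∈ G := Subgroup.subset_closure (by simp)
  have h2 : sigma2 ∈ G := Subgroup.subset_closure (by simp)
  have i1 := weylE8_le_isometries sigma1_mem_weylE8
  have i2 := weylE8_le_isometries sigma2_mem_weylE8
  have hfix : ∀ v ∈ isometries, v⁻¹ clsA = clsA → v⁻¹ clsB = clsB → v ∈ G := by
    intro v hv ha hb
    have hv' : v⁻¹ ∈ pointwiseFixer := ⟨inv_mem hv, ha, hb⟩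
    rw [pointwiseFixer_eq] at hv'
    exact inv_mem_iff.1 (Subgroup.closure_mono Set.subset_union_left hv')
  -- it suffices to find an element of the group generated by `σ₁, σ₂` with the same action
  have hred : ∀ s ∈ G, s ∈ isometries → s (w⁻¹ clsA) = clsA → s (w⁻¹ clsB) = clsB → w ∈ G := by
    intro s hs hs' ha hb
    have := hfix (w * s⁻¹) (mul_mem hw (inv_mem hs'))
      (by rw [mul_inv_rev, inv_inv, LinearEquiv.mul_apply, ha])
      (by rw [mul_inv_rev, inv_inv, LinearEquiv.mul_apply, hb])
    simpa using mul_mem this hs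
  rcases h with ⟨ha | ha, hb | hb⟩ | ⟨ha | ha, hb | hb⟩
  · exact hred 1 (one_mem _) (one_mem _) ha hb
  · exact hred (sigma1 ^ 2 * sigma2) (mul_mem (pow_mem h1 2) h2) (mul_mem (pow_mem i1 2) i2)
      (by rw [ha]; decide) (by rw [hb]; decide)
  · exact hred sigma2 h2 i2 (by rw [ha]; decide) (by rw [hb]; decide)
  · exact hred (sigma1 ^ 2) (pow_mem h1 2) (pow_mem i1 2) (by rw [ha]; decide) (by rw [hb]; decide)
  · exact hred (sigma2 * sigma1) (mul_mem h2 h1) (mul_mem i2 i1)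
      (by rw [ha]; decide) (by rw [hb]; decide)
  · exact hred (sigma1 ^ 3) (pow_mem h1 3) (pow_mem i1 3) (by rw [ha]; decide) (by rw [hb]; decide)
  · exact hred sigma1 h1 i1 (by rw [ha]; decide) (by rw [hb]; decide)
  · exact hred (sigma2 * sigma1 ^ 3) (mul_mem h2 (pow_mem h1 3)) (mul_mem i2 (pow_mem i1 3))
      (by rw [ha]; decide) (by rw [hb]; decide)

theorem closure_le_preservingSubgroup (τ : ℂ) :
    Subgroup.closure (Set.range wBeta ∪ {sigma1, sigma2}) ≤ preservingSubgroup τ := by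
  rw [Subgroup.closure_le]
  rintro w (⟨i, rfl⟩ | rfl | rfl)
  · have h := inv_mem (wBeta_mem_pointwiseFixer i)
    exact PreservesSpan.mem_preservingSubgroup (.inl ⟨.inl h.2.1, .inl h.2.2⟩)
      (wBeta_mem_weylE8 i) τ
  · exact PreservesSpan.mem_preservingSubgroup (.inr ⟨.inr sigma1_inv_clsA, .inl sigma1_inv_clsB⟩)
      sigma1_mem_weylE8 τ
  · exact PreservesSpan.mem_preservingSubgroup (.inl ⟨.inr sigma2_inv_clsA, .inl sigma2_inv_clsB⟩)
      sigma2_mem_weylE8 τ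

/-! ### Existence of generic parameters -/

theorem mem_closure_one_tau {τ z : ℂ} (h : z ∈ AddSubgroup.closure ({1, τ} : Set ℂ)) :
    ∃ m n : ℤ, z = m + n * τ := by
  obtain ⟨m, n, h⟩ := AddSubgroup.mem_closure_pair.1 h
  exact ⟨m, n, by simpa using h.symm⟩

/-- A combination of the powers `x, …, x⁷` of a transcendental number that is an integer
is trivial. -/
theorem eq_zero_of_transcendental {x : ℝ} (hx : Transcendental ℤ x) (c : Fin 7 → ℤ) (m : ℤ)
    (h : ∑ i, (c i : ℝ) * x ^ (i.1 + 1) = m) : ∀ i, c i = 0 := by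
  have hli : LinearIndependent ℤ fun i : ℕ => x ^ i := by
    have h1 := transcendental_iff_injective.1 hx
    have h2 := (Polynomial.basisMonomials ℤ).linearIndependent.map'
      (Polynomial.aeval x).toLinearMap (LinearMap.ker_eq_bot.2 h1)
    have h3 : (fun i : ℕ => x ^ i) =
        (Polynomial.aeval (R := ℤ) x).toLinearMap ∘ Polynomial.basisMonomials ℤ := by
      ext i
      simp
    rw [h3]
    exact h2
  have h8 : LinearIndependent ℤ fun i : Fin 8 => x ^ (i : ℕ) := hli.comp _ Fin.val_injective
  -- The integer `m` enters as the coefficient of the zeroth power, which is why the powers start at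
  -- 1.
  have := Fintype.linearIndependent_iff.1 h8 (Fin.cons (-m) c) (by
    rw [Fin.sum_univ_succ]
    simp only [Fin.cons_zero, Fin.cons_succ, zsmul_eq_mul, Fin.val_succ, Fin.val_zero, pow_zero]
    rw [h]
    push_cast
    ring)
  intro i
  simpa using this i.succ

/-- Parameters with prescribed values of `ι^* β_i` that satisfy the constraint. -/
noncomputable def parametersOfRoots (τ : ℂ) (t : Fin 7 → ℝ) : Parameters (Torus τ) :=
  let hy : ℝ := t 2 + t 0 / 2 + t 1 / 2
  let s : ℝ := (hy - t 4 - t 5 / 2 - t 6 / 2) / 2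
  { hx := (((t 3 + hy : ℝ) : ℂ) : Torus τ)
    hy := ((hy : ℂ) : Torus τ)
    e := fun k => (((![t 0 / 2, -(t 0 / 2), s + t 5 / 2, s - t 5 / 2, t 1 / 2, -(t 1 / 2),
      s + t 6 / 2, s - t 6 / 2] k : ℝ) : ℂ) : Torus τ) }

theorem parametersOfRoots_constraint (τ : ℂ) (t : Fin 7 → ℝ) :
    (parametersOfRoots τ t).Constraint := by
  constructor <;>
  · simp only [parametersOfRoots, ← QuotientAddGroup.mk_add, ← QuotientAddGroup.mk_sub,
      ← Complex.ofReal_add, ← Complex.ofReal_sub, Matrix.cons_val]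
    rw [← QuotientAddGroup.mk_zero, ← Complex.ofReal_zero]
    congr 2
    ring

theorem pullback_parametersOfRoots (τ : ℂ) (t : Fin 7 → ℝ) (i : Fin 7) :
    (parametersOfRoots τ t).pullback (beta i) = ((t i : ℂ) : Torus τ) := by
  fin_cases i <;>
  · simp only [beta, Fin.zero_eta, Fin.mk_one, Fin.reduceFinMk, Matrix.cons_val, map_sub,
      Parameters.pullback_E, Parameters.pullback_Hx, Parameters.pullback_Hy, parametersOfRoots,
      ← QuotientAddGroup.mk_sub]
    congr 1
    push_cast
    ring

theorem exists_isGeneric {τ : ℂ} (hτ : 0 < τ.im) :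
    ∃ p : Parameters (Torus τ), p.Constraint ∧ p.IsGeneric := by
  -- Real root values suffice: a real point of ℤ + ℤτ is an integer since Im τ > 0, and a
  -- transcendental number has no integral relation among its powers.
  obtain ⟨x, hx⟩ : ∃ x : ℝ, Transcendental ℤ x :=
    ⟨_, transcendental_liouvilleNumber (m := 2) le_rfl⟩
  refine ⟨parametersOfRoots τ fun i => x ^ (i.1 + 1), parametersOfRoots_constraint _ _, ?_⟩
  rw [Parameters.IsGeneric, Fintype.linearIndependent_iff]
  intro c hc
  simp only [pullback_parametersOfRoots] at hc
  have hmem : ((∑ i, (c i : ℝ) * x ^ (i.1 + 1) : ℝ) : ℂ) ∈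
      AddSubgroup.closure ({1, τ} : Set ℂ) := by
    rw [← QuotientAddGroup.eq_zero_iff, ← hc]
    push_cast
    rw [← QuotientAddGroup.mk'_apply, map_sum]
    refine Finset.sum_congr rfl fun i _ => ?_
    rw [← zsmul_eq_mul, map_zsmul]
    rfl
  obtain ⟨m, n, h⟩ := mem_closure_one_tau hmem
  have him := congrArg Complex.im h
  have hn : n = 0 := by
    rw [Complex.ofReal_im, Complex.add_im, Complex.mul_im, Complex.intCast_im, Complex.intCast_im,
      Complex.intCast_re, zero_mul, zero_add, add_zero] at him
    exact_mod_cast (mul_eq_zero.1 him.symm).resolve_right hτ.ne'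
  refine eq_zero_of_transcendental hx c m ?_
  rw [hn, Int.cast_zero, zero_mul, add_zero] at h
  exact_mod_cast h

theorem preservingSubgroup_eq {τ : ℂ} (hτ : 0 < τ.im) :
    preservingSubgroup τ = Subgroup.closure (Set.range wBeta ∪ {sigma1, sigma2}) := by
  refine le_antisymm (fun w hw => ?_) (closure_le_preservingSubgroup τ)
  obtain ⟨p, hp, hg⟩ := exists_isGeneric hτ
  have hi := weylE8_le_isometries hw.1
  exact (preservesSpan_of_isGeneric hp hg hi ((hw.2 p).2 hp)).mem_closure hi

theorem mem_preservingSubgroup_of_isGeneric {τ : ℂ} {p : Parameters (Torus τ)}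
    (hp : p.Constraint) (hg : p.IsGeneric) {w : Pic ≃ₗ[ℤ] Pic} (hw : w ∈ weylE8)
    (h : (p.evolve w).Constraint) : w ∈ preservingSubgroup τ :=
  (preservesSpan_of_isGeneric hp hg (weylE8_le_isometries hw) h).mem_preservingSubgroup hw τ

theorem linearIndependent_beta : LinearIndependent ℤ beta := by
  rw [Fintype.linearIndependent_iff]
  intro n hn
  have h0 : (0 : Pic) = vec 0 0 0 0 0 0 0 0 0 0 := by decide
  simp only [Fin.sum_univ_seven, beta_zero, beta_one, beta_two, beta_three, beta_four, beta_five,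
    beta_six, vec_smul, vec_add, h0, vec_inj] at hn
  intro i
  fin_cases i <;> simp <;> omega

/-- An element that preserves the span of the classes of the constraint and fixes the `β_i` is
the identity. -/
theorem PreservesSpan.eq_one {g : Pic ≃ₗ[ℤ] Pic} (h : PreservesSpan g⁻¹) (hg : g ∈ isometries)
    (hb : ∀ i, g (beta i) = beta i) : g = 1 := by
  refine eq_one_of_fixes (g := g) ?_ hb
  suffices g clsA = clsA ∧ g clsB = clsB from ⟨hg, this⟩
  simp only [PreservesSpan, inv_inv] at h
  -- The gluing relations again, now with the `beta i` fixed: exchanging A and B fails modulo 2, and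
  -- the remaining sign changes fail modulo 4.
  have h2 := congrArg g two_smul_E_sub
  have h4 := congrArg g four_smul_E_sub
  simp only [map_smul, map_add, map_sub, hb] at h2 h4
  obtain ⟨x, y, z1, z2, z3, z4, z5, z6, z7, z8, hx⟩ := exists_vec (g (E 0) - g (E 5))
  obtain ⟨x', y', z1', z2', z3', z4', z5', z6', z7', z8', hx'⟩ := exists_vec (g (E 0) - g (E 2))
  rw [hx] at h2
  rw [hx'] at h4
  rcases h with ⟨ha | ha, hb | hb⟩ | ⟨ha | ha, hb | hb⟩
  · exact ⟨ha, hb⟩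
  all_goals
    exfalso
    rw [ha] at h2
    rw [ha, hb] at h4
    simp only [beta_zero, beta_one, beta_two, beta_four, beta_five, beta_six, clsA, clsB,
      vec_smul, vec_add, vec_sub, vec_neg, vec_inj] at h2 h4
    omega

/-! ### The diagram automorphisms as the dihedral group -/

theorem diagram1_pow_four : diagram1 ^ 4 = 1 := by
  ext i; revert i; decide

theorem diagram2_sq : diagram2 ^ 2 = 1 := by
  ext i; revert i; decide

theorem diagram2_mul_diagram1_sq : (diagram2 * diagram1) ^ 2 = 1 := by
  ext i; revert i; decide

section Dihedral

variable {G : Type*} [Group G] {s t : G} (hs : s ^ 4 = 1) (ht : t ^ 2 = 1) (hts : (t * s) ^ 2 = 1)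

theorem pow_zmod_val_add (hs : s ^ 4 = 1) (i j : ZMod 4) :
    s ^ (i + j).val = s ^ i.val * s ^ j.val := by
  rw [← pow_add, ZMod.val_add, ← pow_mod_orderOf, ← pow_mod_orderOf s (i.val + j.val),
    Nat.mod_mod_of_dvd _ (orderOf_dvd_of_pow_eq_one hs)]

theorem pow_zmod_val_neg (hs : s ^ 4 = 1) (i : ZMod 4) : s ^ (-i).val = (s ^ i.val)⁻¹ := by
  rw [eq_inv_iff_mul_eq_one, ← pow_zmod_val_add hs, neg_add_cancel, ZMod.val_zero, pow_zero]

/-- The relations say that `t` is an involution inverting `s`, hence every power of `s`. -/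
theorem conj_pow_of_sq (ht : t ^ 2 = 1) (hts : (t * s) ^ 2 = 1) (n : ℕ) :
    t * s ^ n * t = (s ^ n)⁻¹ := by
  have h1 : t⁻¹ = t := inv_eq_of_mul_eq_one_left (by rw [← pow_two, ht])
  have h2 : t * s * t⁻¹ = s⁻¹ := by
    rw [h1]
    refine eq_inv_of_mul_eq_one_left ?_
    rw [← hts, pow_two]
    group
  calc t * s ^ n * t = t * s ^ n * t⁻¹ := by rw [h1]
    _ = (t * s * t⁻¹) ^ n := (conj_pow).symm
    _ = (s ^ n)⁻¹ := by rw [h2, inv_pow]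

/-- The homomorphism from the dihedral group of order eight determined by two elements that
satisfy the dihedral relations. -/
def dihedralLift (hs : s ^ 4 = 1) (ht : t ^ 2 = 1) (hts : (t * s) ^ 2 = 1) :
    DihedralGroup 4 →* G :=
  MonoidHom.mk' (fun
    | .r i => s ^ i.val
    | .sr i => t * s ^ i.val) (by
    have hc := conj_pow_of_sq ht hts
    have htt : t * t = 1 := by rw [← pow_two, ht]
    have hst : ∀ n, s ^ n * t = t * (s ^ n)⁻¹ := fun n => by
      rw [← hc n, ← mul_assoc, ← mul_assoc, htt, one_mul]
    rintro (i | i) (j | j)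
    · simp only [DihedralGroup.r_mul_r, pow_zmod_val_add hs]
    · simp only [DihedralGroup.r_mul_sr, sub_eq_add_neg, pow_zmod_val_add hs, pow_zmod_val_neg hs]
      rw [← mul_assoc (s ^ i.val), hst, mul_assoc t, ← pow_zmod_val_neg hs,
        ← pow_zmod_val_add hs, ← pow_zmod_val_add hs, add_comm]
    · simp only [DihedralGroup.sr_mul_r, pow_zmod_val_add hs, mul_assoc]
    · simp only [DihedralGroup.sr_mul_sr, sub_eq_add_neg, pow_zmod_val_add hs,
        pow_zmod_val_neg hs]
      rw [← mul_assoc, mul_assoc t, hst, ← mul_assoc, htt, one_mul, ← pow_zmod_val_neg hs,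
        ← pow_zmod_val_add hs, ← pow_zmod_val_add hs, add_comm])

theorem dihedralLift_r_one : dihedralLift hs ht hts (.r 1) = s := pow_one s

theorem dihedralLift_sr_zero : dihedralLift hs ht hts (.sr 0) = t := by
  change t * s ^ 0 = t
  rw [pow_zero, mul_one]

end Dihedral

/-- The homomorphism from the dihedral group of order eight to the diagram automorphisms. -/
def dihedralToAut : DihedralGroup 4 →* autD6 :=
  dihedralLift diagram1_pow_four diagram2_sq diagram2_mul_diagram1_sq

theorem dihedralToAut_injective : Function.Injective dihedralToAut := by
  rw [injective_iff_map_eq_one]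
  intro x hx
  have hx' : ∀ i, (dihedralToAut x : Equiv.Perm (Fin 7)) i = i := fun i => by rw [hx]; rfl
  -- Only the identity of the dihedral group fixes a leaf at each end.
  have h0 := hx' 0
  have h5 := hx' 5
  rcases x with i | i <;> fin_cases i
  · rfl
  all_goals
    exfalso
    revert h0 h5
    decide

theorem dihedralToAut_surjective : Function.Surjective dihedralToAut := by
  intro π
  have key : ∀ x : DihedralGroup 4, (π : Fin 7 → Fin 7) = (dihedralToAut x : Equiv.Perm (Fin 7)) →
      ∃ x, dihedralToAut x = π := fun x hx => ⟨x, Subtype.ext (DFunLike.coe_injective hx.symm)⟩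
  have h := diagram_automorphism_mem π.1 π.2
  simp only [Finset.mem_insert, Finset.mem_singleton] at h
  rcases h with h | h | h | h | h | h | h | h
  · exact key (.r 0) (h.trans (by decide))
  · exact key (.sr 0) (h.trans (by decide))
  · exact key (.sr 2) (h.trans (by decide))
  · exact key (.r 2) (h.trans (by decide))
  · exact key (.sr 1) (h.trans (by decide))
  · exact key (.r 3) (h.trans (by decide))
  · exact key (.r 1) (h.trans (by decide))
  · exact key (.sr 3) (h.trans (by decide))

/-- The group of diagram automorphisms is the dihedral group of order eight. -/
noncomputable def dihedralEquivAut : DihedralGroup 4 ≃* autD6 :=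
  MulEquiv.ofBijective dihedralToAut ⟨dihedralToAut_injective, dihedralToAut_surjective⟩

theorem presented_relator {r : FreeGroup (Fin 2)} (hr : r ∈ dihedralRelators) :
    PresentedGroup.mk dihedralRelators r = 1 :=
  PresentedGroup.one_of_mem hr

/-- The homomorphism from the dihedral group of order eight to the presented group. -/
def dihedralToPresented : DihedralGroup 4 →* PresentedGroup dihedralRelators :=
  dihedralLift (s := PresentedGroup.of 0) (t := PresentedGroup.of 1)
    (presented_relator (r := FreeGroup.of 0 ^ 4) (by simp [dihedralRelators]))
    (presented_relator (r := FreeGroup.of 1 ^ 2) (by simp [dihedralRelators]))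
    (presented_relator (r := (FreeGroup.of 1 * FreeGroup.of 0) ^ 2) (by simp [dihedralRelators]))

/-- The homomorphism from the presented group to the dihedral group of order eight. -/
def presentedToDihedral : PresentedGroup dihedralRelators →* DihedralGroup 4 :=
  PresentedGroup.toGroup (f := ![.r 1, .sr 0]) (by
    rintro r (rfl | rfl | rfl) <;> simp [FreeGroup.lift_apply_of] <;> decide)

theorem presentedToDihedral_of (i : Fin 2) :
    presentedToDihedral (PresentedGroup.of i) = (![.r 1, .sr 0] : Fin 2 → DihedralGroup 4) i :=
  PresentedGroup.toGroup.of _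

/-- The dihedral group of order eight is the group with the generators `s₁, s₂` and the relations
`s₁⁴ = s₂² = (s₂ s₁)² = e`. -/
def presentedEquivDihedral : PresentedGroup dihedralRelators ≃* DihedralGroup 4 :=
  MonoidHom.toMulEquiv presentedToDihedral dihedralToPresented
    (by
      ext i
      rw [MonoidHom.comp_apply, presentedToDihedral_of]
      fin_cases i
      · exact dihedralLift_r_one ..
      · exact dihedralLift_sr_zero ..)
    (by
      ext x
      have h1 : presentedToDihedral (PresentedGroup.of 0) = .r 1 := presentedToDihedral_of 0
      have h2 : presentedToDihedral (PresentedGroup.of 1) = .sr 0 := presentedToDihedral_of 1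
      rw [MonoidHom.comp_apply, MonoidHom.id_apply]
      rcases x with i | i
      · change presentedToDihedral (PresentedGroup.of 0 ^ i.val) = _
        rw [map_pow, h1]
        revert i; decide
      · change presentedToDihedral (PresentedGroup.of 1 * PresentedGroup.of 0 ^ i.val) = _
        rw [map_mul, map_pow, h1, h2]
        revert i; decide)

theorem presentedEquivDihedral_of_zero :
    presentedEquivDihedral (PresentedGroup.of 0) = .r 1 :=
  presentedToDihedral_of 0

theorem presentedEquivDihedral_of_one :
    presentedEquivDihedral (PresentedGroup.of 1) = .sr 0 :=
  presentedToDihedral_of 1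

theorem dihedralEquivAut_r_one : dihedralEquivAut (.r 1) = diagram1 :=
  dihedralLift_r_one diagram1_pow_four diagram2_sq diagram2_mul_diagram1_sq

theorem dihedralEquivAut_sr_zero : dihedralEquivAut (.sr 0) = diagram2 :=
  dihedralLift_sr_zero diagram1_pow_four diagram2_sq diagram2_mul_diagram1_sq

/-! ### The isomorphism with the extended affine Weyl group -/

/-- The linear map from the abstract root lattice that sends the simple roots to the `β_i`. -/
def rootMap : RootLatticeD6 →ₗ[ℤ] Pic := Fintype.linearCombination ℤ beta

theorem rootMap_single (i : Fin 7) : rootMap (Pi.single i 1) = beta i := by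
  rw [rootMap, Fintype.linearCombination_apply_single, one_smul]

theorem rootMap_injective : Function.Injective rootMap :=
  linearIndependent_beta.fintypeLinearCombination_injective

/-- An automorphism `g` of the Picard lattice extends an automorphism `f` of the abstract root
lattice. -/
def Extends (f : RootLatticeD6 ≃ₗ[ℤ] RootLatticeD6) (g : Pic ≃ₗ[ℤ] Pic) : Prop :=
  ∀ v, g (rootMap v) = rootMap (f v)

theorem extends_of_single {f : RootLatticeD6 ≃ₗ[ℤ] RootLatticeD6} {g : Pic ≃ₗ[ℤ] Pic}
    (h : ∀ i, g (beta i) = rootMap (f (Pi.single i 1))) : Extends f g := by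
  have : (g : Pic →ₗ[ℤ] Pic) ∘ₗ rootMap = rootMap ∘ₗ (f : RootLatticeD6 →ₗ[ℤ] RootLatticeD6) := by
    refine (Pi.basisFun ℤ (Fin 7)).ext fun i => ?_
    rw [Pi.basisFun_apply]
    change g (rootMap (Pi.single i 1)) = _
    rw [rootMap_single, h]
    rfl
  exact fun v => LinearMap.congr_fun this v

theorem Extends.one : Extends 1 1 := fun _ => rfl

theorem Extends.mul {f f' : RootLatticeD6 ≃ₗ[ℤ] RootLatticeD6} {g g' : Pic ≃ₗ[ℤ] Pic}
    (h : Extends f g) (h' : Extends f' g') : Extends (f * f') (g * g') := fun v => by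
  rw [LinearEquiv.mul_apply, LinearEquiv.mul_apply, h', h]

theorem Extends.inv {f : RootLatticeD6 ≃ₗ[ℤ] RootLatticeD6} {g : Pic ≃ₗ[ℤ] Pic}
    (h : Extends f g) : Extends f⁻¹ g⁻¹ := fun v => by
  have h1 : f (f⁻¹ v) = v := f.apply_symm_apply v
  have h2 : ∀ D, g⁻¹ (g D) = D := g.symm_apply_apply
  rw [← h2 (rootMap (f⁻¹ v)), h, h1]

theorem extends_wBeta (i : Fin 7) : Extends (simpleReflD6 i) (wBeta i) := by
  refine extends_of_single fun j => ?_
  rw [wBeta_apply, inter_beta, simpleReflD6, Module.reflection_apply, map_sub, map_smul,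
    Fintype.linearCombination_apply_single, rootMap_single, rootMap_single, one_smul, neg_smul,
    sub_eq_add_neg]

theorem permLattice_single (π : Equiv.Perm (Fin 7)) (i : Fin 7) :
    permLattice π (Pi.single i 1) = Pi.single (π i) 1 := by
  ext l
  simp [permLattice, LinearEquiv.funCongrLeft, LinearMap.funLeft, Pi.single_apply,
    Equiv.symm_apply_eq]

theorem extends_sigma1 : Extends (permLattice perm1) sigma1 :=
  extends_of_single fun i => by rw [permLattice_single, rootMap_single, sigma1_beta]

theorem extends_sigma2 : Extends (permLattice perm2) sigma2 :=
  extends_of_single fun i => by rw [permLattice_single, rootMap_single, sigma2_beta]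

theorem exists_extends_of_mem_weylD6 {f : RootLatticeD6 ≃ₗ[ℤ] RootLatticeD6} (hf : f ∈ weylD6) :
    ∃ g ∈ reflectionsB, Extends f g := by
  induction hf using Subgroup.closure_induction with
  | mem f hf =>
    obtain ⟨i, rfl⟩ := hf
    exact ⟨wBeta i, wBeta_mem_reflectionsB i, extends_wBeta i⟩
  | one => exact ⟨1, one_mem _, .one⟩
  | mul f f' _ _ h h' =>
    obtain ⟨g, hg, h⟩ := h
    obtain ⟨g', hg', h'⟩ := h'
    exact ⟨g * g', mul_mem hg hg', h.mul h'⟩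
  | inv f _ h =>
    obtain ⟨g, hg, h⟩ := h
    exact ⟨g⁻¹, inv_mem hg, h.inv⟩

/-- The action of the extended affine Weyl group on the abstract root lattice. -/
def extendedAction : ExtendedWeylD6 →* (RootLatticeD6 ≃ₗ[ℤ] RootLatticeD6) :=
  SemidirectProduct.lift weylD6.subtype (permLattice.comp autD6.subtype) fun _ => rfl

theorem extendedAction_inl (w : weylD6) : extendedAction (SemidirectProduct.inl w) = w :=
  SemidirectProduct.lift_inl (h := fun _ => rfl) ..

theorem extendedAction_inr (π : autD6) :
    extendedAction (SemidirectProduct.inr π) = permLattice π :=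
  SemidirectProduct.lift_inr (h := fun _ => rfl) ..

theorem extendedAction_simpleGen (i : Fin 7) : extendedAction (simpleGen i) = simpleReflD6 i :=
  extendedAction_inl _

/-- A diagram automorphism that acts on the root lattice as an element of the Weyl group is
trivial. -/
theorem eq_one_of_permLattice_mem {π : autD6} (h : permLattice π ∈ weylD6) : π = 1 := by
  -- The extension to the Picard lattice is a product of the `wBeta`, so it fixes A and B, and no
  -- nontrivial diagram automorphism does.
  obtain ⟨g, hg, he⟩ := exists_extends_of_mem_weylD6 h
  obtain ⟨_, ha, hb⟩ := reflectionsB_le hg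
  have hgb : ∀ i, g (beta i) = beta (π.1 i) := fun i => by
    rw [← rootMap_single, he, permLattice_single, rootMap_single]
  exact Subtype.ext (Equiv.ext (permutation_eq_id ha hb π.2 hgb))

/-- Faithfulness amounts to the Weyl group and the diagram automorphisms meeting trivially on the
root lattice. -/
theorem extendedAction_injective : Function.Injective extendedAction := by
  rw [injective_iff_map_eq_one]
  intro x hx
  rw [← SemidirectProduct.inl_left_mul_inr_right x, map_mul, extendedAction_inl,
    extendedAction_inr] at hx
  have h1 : x.right = 1 := eq_one_of_permLattice_mem (by
    rw [← inv_eq_of_mul_eq_one_right hx]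
    exact inv_mem x.left.2)
  rw [h1] at hx
  ext1
  · refine Subtype.ext ?_
    simpa using hx
  · exact h1

variable {τ : ℂ}

theorem wBeta_mem_preservingSubgroup (i : Fin 7) : wBeta i ∈ preservingSubgroup τ :=
  closure_le_preservingSubgroup τ (Subgroup.subset_closure (.inl ⟨i, rfl⟩))

theorem sigma1_mem_preservingSubgroup : sigma1 ∈ preservingSubgroup τ :=
  closure_le_preservingSubgroup τ (Subgroup.subset_closure (.inr (by simp)))

theorem sigma2_mem_preservingSubgroup : sigma2 ∈ preservingSubgroup τ :=
  closure_le_preservingSubgroup τ (Subgroup.subset_closure (.inr (by simp)))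

theorem exists_extends_permLattice (π : autD6) :
    ∃ g ∈ preservingSubgroup τ, Extends (permLattice π) g := by
  have key : ∀ n : ℕ, ∃ g ∈ preservingSubgroup τ, Extends (permLattice perm1 ^ n) g := fun n => by
    induction n with
    | zero => exact ⟨1, one_mem _, .one⟩
    | succ n ih =>
      obtain ⟨g, hg, h⟩ := ih
      exact ⟨g * sigma1, mul_mem hg sigma1_mem_preservingSubgroup,
        by rw [pow_succ]; exact h.mul extends_sigma1⟩
  obtain ⟨x, rfl⟩ := dihedralToAut_surjective π
  rcases x with i | i
  · obtain ⟨g, hg, h⟩ := key i.val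
    have e : (dihedralToAut (.r i) : Equiv.Perm (Fin 7)) = perm1 ^ i.val :=
      Subgroup.coe_pow autD6 diagram1 i.val
    rw [e, map_pow]
    exact ⟨g, hg, h⟩
  · obtain ⟨g, hg, h⟩ := key i.val
    have e : (dihedralToAut (.sr i) : Equiv.Perm (Fin 7)) = perm2 * perm1 ^ i.val :=
      congrArg (perm2 * ·) (Subgroup.coe_pow autD6 diagram1 i.val)
    rw [e, map_mul, map_pow]
    exact ⟨sigma2 * g, mul_mem sigma2_mem_preservingSubgroup hg, extends_sigma2.mul h⟩

theorem exists_extends_extendedAction (x : ExtendedWeylD6) :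
    ∃ g : preservingSubgroup τ, Extends (extendedAction x) g := by
  obtain ⟨g, hg, h⟩ := exists_extends_of_mem_weylD6 x.left.2
  obtain ⟨g', hg', h'⟩ := exists_extends_permLattice (τ := τ) x.right
  have hle : reflectionsB ≤ preservingSubgroup τ :=
    (Subgroup.closure_mono Set.subset_union_left).trans (closure_le_preservingSubgroup τ)
  refine ⟨⟨g, hle hg⟩ * ⟨g', hg'⟩, ?_⟩
  rw [← SemidirectProduct.inl_left_mul_inr_right x, map_mul, extendedAction_inl,
    extendedAction_inr]
  exact h.mul h'

theorem exists_extendedAction_extends (hτ : 0 < τ.im) (g : preservingSubgroup τ) :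
    ∃ x : ExtendedWeylD6, Extends (extendedAction x) g := by
  obtain ⟨g, hg⟩ := g
  change ∃ x, Extends (extendedAction x) g
  have hcl := (preservingSubgroup_eq hτ).le hg
  clear hg
  induction hcl using Subgroup.closure_induction with
  | mem g hg =>
    rcases hg with ⟨i, rfl⟩ | rfl | rfl
    · exact ⟨simpleGen i, by rw [extendedAction_simpleGen]; exact extends_wBeta i⟩
    · exact ⟨SemidirectProduct.inr diagram1, by rw [extendedAction_inr]; exact extends_sigma1⟩
    · exact ⟨SemidirectProduct.inr diagram2, by rw [extendedAction_inr]; exact extends_sigma2⟩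
  | one => exact ⟨1, by rw [map_one]; exact .one⟩
  | mul g g' _ _ h h' =>
    obtain ⟨x, h⟩ := h
    obtain ⟨x', h'⟩ := h'
    exact ⟨x * x', by rw [map_mul]; exact h.mul h'⟩
  | inv g _ h =>
    obtain ⟨x, h⟩ := h
    exact ⟨x⁻¹, by rw [map_inv]; exact h.inv⟩

/-- An element that preserves the constraint is determined by its action on the `β_i`. -/
theorem Extends.unique (hτ : 0 < τ.im) {f : RootLatticeD6 ≃ₗ[ℤ] RootLatticeD6}
    {g g' : preservingSubgroup τ} (h : Extends f g) (h' : Extends f g') : g = g' := by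
  have hm := (g * g'⁻¹).2
  obtain ⟨p, hp, hgen⟩ := exists_isGeneric hτ
  have hmi := inv_mem hm
  have hspan := preservesSpan_of_isGeneric hp hgen (weylE8_le_isometries hmi.1)
    ((hmi.2 p).2 hp)
  -- The quotient of the two extensions fixes all `beta i` and preserves A and B up to order and
  -- sign.
  have hone := hspan.eq_one (weylE8_le_isometries hm.1) fun i => by
    have := h.mul h'.inv (Pi.single i 1)
    rw [mul_inv_cancel, rootMap_single] at this
    exact this.trans (rootMap_single i)
  exact mul_inv_eq_one.1 (Subtype.ext hone)

/-- The subgroup that preserves the constraint is isomorphic to the extended affine Weyl group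
of type `D₆⁽¹⁾`. -/
theorem exists_extendedWeyl_equiv (hτ : 0 < τ.im) :
    ∃ Φ : ExtendedWeylD6 ≃* preservingSubgroup τ,
      (∀ i, (Φ (simpleGen i) : Pic ≃ₗ[ℤ] Pic) = wBeta i) ∧
      (Φ (SemidirectProduct.inr diagram1) : Pic ≃ₗ[ℤ] Pic) = sigma1 ∧
      (Φ (SemidirectProduct.inr diagram2) : Pic ≃ₗ[ℤ] Pic) = sigma2 := by
  -- The chosen extension is the only one, by `Extends.unique`; this makes `F` multiplicative and
  -- identifies its values on the generators.
  choose F hF using exists_extends_extendedAction (τ := τ)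
  have hu : ∀ (x : ExtendedWeylD6) (g : preservingSubgroup τ), Extends (extendedAction x) g →
      F x = g := fun x g h => (hF x).unique hτ h
  let Fh : ExtendedWeylD6 →* preservingSubgroup τ :=
    MonoidHom.mk' F fun x y => hu _ _ (by rw [map_mul]; exact (hF x).mul (hF y))
  have hinj : Function.Injective Fh := fun x y hxy => by
    refine extendedAction_injective (LinearEquiv.ext fun v => rootMap_injective ?_)
    rw [← hF x, ← hF y]
    exact congrArg (fun g : preservingSubgroup τ => (g : Pic ≃ₗ[ℤ] Pic) (rootMap v)) hxy
  have hsurj : Function.Surjective Fh := fun g => by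
    obtain ⟨x, hx⟩ := exists_extendedAction_extends hτ g
    exact ⟨x, hu x g hx⟩
  refine ⟨MulEquiv.ofBijective Fh ⟨hinj, hsurj⟩, fun i => ?_, ?_, ?_⟩
  · exact congrArg Subtype.val (hu (simpleGen i) ⟨wBeta i, wBeta_mem_preservingSubgroup i⟩
      (by rw [extendedAction_simpleGen]; exact extends_wBeta i))
  · exact congrArg Subtype.val (hu _ ⟨sigma1, sigma1_mem_preservingSubgroup⟩
      (by rw [extendedAction_inr]; exact extends_sigma1))
  · exact congrArg Subtype.val (hu _ ⟨sigma2, sigma2_mem_preservingSubgroup⟩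
      (by rw [extendedAction_inr]; exact extends_sigma2))

end EllipticD6

open EllipticD6 in
theorem mainTheorem1 (τ : ℂ) (hτ : 0 < τ.im) :
    -- the subgroup preserving the constraint is generated by the reflections and `σ₁, σ₂`
    preservingSubgroup τ = Subgroup.closure (Set.range wBeta ∪ {sigma1, sigma2}) ∧
    -- for membership one direction is enough
    (∀ w ∈ weylE8, (∀ p : Parameters (Torus τ), p.Constraint → (p.evolve w).Constraint) →
      w ∈ preservingSubgroup τ) ∧
    -- and so is a single generic point of the constrained family, which has such points
    (∃ p : Parameters (Torus τ), p.Constraint ∧ p.IsGeneric) ∧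
    (∀ p : Parameters (Torus τ), p.Constraint → p.IsGeneric →
      ∀ w ∈ weylE8, (p.evolve w).Constraint → w ∈ preservingSubgroup τ) ∧
    -- it is isomorphic to the extended affine Weyl group, generators going to generators
    (∃ Φ : ExtendedWeylD6 ≃* preservingSubgroup τ,
      (∀ i, (Φ (simpleGen i) : Pic ≃ₗ[ℤ] Pic) = wBeta i) ∧
      (Φ (SemidirectProduct.inr diagram1) : Pic ≃ₗ[ℤ] Pic) = sigma1 ∧
      (Φ (SemidirectProduct.inr diagram2) : Pic ≃ₗ[ℤ] Pic) = sigma2) ∧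
    -- the `β_i` in terms of the `α_i`
    (beta 0 = alpha 0 ∧ beta 1 = alpha 6 ∧
      beta 2 = alpha 2 + alpha 3 + alpha 4 + alpha 5 ∧ beta 3 = alpha 1 ∧
      beta 4 = alpha 0 + alpha 2 + (2 : ℤ) • alpha 3 + alpha 4 + alpha 5 + alpha 6 + alpha 7 ∧
      beta 5 = alpha 4 ∧ beta 6 = alpha 8) ∧
    -- the `β_i` are linearly independent with the Dynkin diagram of type `D₆⁽¹⁾`
    (LinearIndependent ℤ beta ∧ ∀ i j, inter (beta i) (beta j) = -cartanD6 i j) ∧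
    -- the diagram automorphisms form the dihedral group of order eight
    (∃ χ : DihedralGroup 4 ≃* autD6,
      χ (DihedralGroup.r 1) = diagram1 ∧ χ (DihedralGroup.sr 0) = diagram2) ∧
    (∃ χ : PresentedGroup dihedralRelators ≃* autD6,
      χ (PresentedGroup.of 0) = diagram1 ∧ χ (PresentedGroup.of 1) = diagram2) ∧
    -- `σ₁, σ₂` permute the `β_i` accordingly
    (∀ i, sigma1 (beta i) = beta (perm1 i) ∧ sigma2 (beta i) = beta (perm2 i)) ∧
    -- the action of `φ^*`, which is not a translation on `Q_B`
    (phiPull (beta 0) = -beta 5 ∧ phiPull (beta 1) = -beta 6 ∧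
      phiPull (beta 2) = -beta 3 - beta 4 ∧
      phiPull (beta 3) = beta 3 + (2 : ℤ) • beta 4 + beta 5 + beta 6 ∧
      phiPull (beta 4) = beta 0 + beta 1 + beta 2 + beta 3 ∧
      phiPull (beta 5) = -beta 0 ∧ phiPull (beta 6) = -beta 1) ∧
    ¬ IsTranslationOn latticeB phiPull ∧
    -- the action of `(φ²)^*`, which is a translation on `Q_B`
    (∀ i, (phiPull ^ 2) (beta i) = beta i + (![0, 0, -1, 1, 0, 0, 0] : Fin 7 → ℤ) i • delta) ∧
    IsTranslationOn latticeB (phiPull ^ 2) ∧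
    delta = beta 0 + beta 1 + (2 : ℤ) • beta 2 + (2 : ℤ) • beta 3 + (2 : ℤ) • beta 4
      + beta 5 + beta 6 ∧
    -- the words of `φ^*` and `(φ²)^*`, and the inverse words of `φ_*` and `(φ²)_*`
    phiPull = sigma1 ^ 3 * wBeta 6 * wBeta 5 * wBeta 3 * wBeta 2 * wBeta 1 * wBeta 0 *
      wBeta 2 * wBeta 1 * wBeta 0 ∧
    phiPull ^ 2 = sigma1 ^ 2 * wBeta 3 * wBeta 4 * wBeta 6 * wBeta 5 * wBeta 4 * wBeta 3 *
      wBeta 2 * wBeta 1 * wBeta 0 * wBeta 2 ∧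
    phiPush = wBeta 0 * wBeta 1 * wBeta 2 * wBeta 0 * wBeta 1 * wBeta 2 * wBeta 3 *
      wBeta 5 * wBeta 6 * sigma1 ∧
    phiPush ^ 2 = wBeta 2 * wBeta 0 * wBeta 1 * wBeta 2 * wBeta 3 * wBeta 4 * wBeta 5 *
      wBeta 6 * wBeta 4 * wBeta 3 * sigma1 ^ 2 ∧
    -- the effect of `σ₁²` on the Dynkin diagram
    perm1 ^ 2 = c[0, 1] * c[5, 6] := by
  refine ⟨preservingSubgroup_eq hτ, fun w hw h => ?_, exists_isGeneric hτ,
    fun p hp hg w hw h => mem_preservingSubgroup_of_isGeneric hp hg hw h,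
    exists_extendedWeyl_equiv hτ, beta_eq_alpha, ⟨linearIndependent_beta, inter_beta⟩,
    ⟨dihedralEquivAut, dihedralEquivAut_r_one, dihedralEquivAut_sr_zero⟩,
    ⟨presentedEquivDihedral.trans dihedralEquivAut, ?_, ?_⟩,
    fun i => ⟨sigma1_beta i, sigma2_beta i⟩, phiPull_beta, phiPull_not_isTranslationOn,
    phiPull_sq_beta, phiPull_sq_isTranslationOn, delta_eq_beta, phiPull_word, phiPull_sq_word,
    phiPush_word, phiPush_sq_word, by decide⟩
  -- The one-sided hypothesis is used at a single generic point only.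
  · obtain ⟨p, hp, hg⟩ := exists_isGeneric hτ
    exact mem_preservingSubgroup_of_isGeneric hp hg hw (h p hp)
  · rw [MulEquiv.trans_apply, presentedEquivDihedral_of_zero, dihedralEquivAut_r_one]
  · rw [MulEquiv.trans_apply, presentedEquivDihedral_of_one, dihedralEquivAut_sr_zero]
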